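/- Let $T^2=\mathbb R^2/(2\pi\mathbb Z)^2$ be the flat torus, and let $A$ be a smooth $U(1)$ connection on a Hermitian line bundle $E$ over $T^2$ with uniform magnetic field (curvature) $B=\partial_1A_2-\partial_2A_1=k/2\pi$, where $k=1$, so that $E$ has first Chern class $1$. Here sections of $E$ are the functions $\psi$ on $\mathbb R^2$ with $\psi(x+2\pi e_j)=e^{i\chi_j(x)}\psi(x)$ ($j=1,2$) for smooth real phases $\chi_j$ satisfying the cocycle condition, $A$ satisfies $A(x+2\pi e_j)=A(x)+\nabla\chi_j(x)$, and the covariant derivative is $D_j=\partial_j-iA_j$. Let $\phi_1^{\pm}$ be such that the holonomy of $A$ along the circle $t\mapsto(\phi_1^{\pm},t)$, $t\in[0,2\pi]$, equals $\pm1$, let $\phi_2^{\pm}$ be such that the holonomy of $A$ along the circle $t\mapsto(t,\phi_2^{\pm})$ equals $\pm1$, and put $\phi_{ab}=(\phi_1^a,\phi_2^b)$ for $a,b\in\{+,-\}$. Let $V$ be a bounded measurable real potential on $T^2$ that is $P_{++}$-symmetric, i.e. $V(2\phi_1^+-\varphi_1,\,2\phi_2^+-\varphi_2)=V(\varphi_1,\varphi_2)$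 for all $(\varphi_1,\varphi_2)$. Let $H_A=-\tfrac12(D_1^2+D_2^2)+V$, as the closure in $L^2(T^2,E)$ of its restriction to the smooth sections of $E$, and for $T>0$ let $K^A_T(x,y)=\langle x|e^{-TH_A}|y\rangle$ be the heat kernel, i.e. the continuous integral kernel of $e^{-TH_A}$ (a section of $E$ in $x$ and of the dual bundle $E^*$ in $y$). Then, for every $T>0$, $$K^A_T(\phi_{++},\phi_{--})=K^A_T(\phi_{+-},\phi_{--})=K^A_T(\phi_{-+},\phi_{--})=0 .$$ -/

import Mathlib

noncomputable section

namespace HallTorus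

open Real Set Filter Topology MeasureTheory
open scoped ContDiff

/-- A Hermitian line bundle over the flat torus `T² = ℝ² / (2πℤ)²` together with a `U(1)` connection
whose magnetic field is uniform and equal to `B = k / 2π`, described on the universal cover `ℝ²`.
Sections of the bundle are the functions `ψ` on `ℝ²` with
`ψ (x + 2π, y) = exp (i χ₁ (x, y)) ψ (x, y)` and `ψ (x, y + 2π) = exp (i χ₂ (x, y)) ψ (x, y)`;
`A = (A₁, A₂)` is the gauge potential, acting on sections through `∂ⱼ - i Aⱼ`.
The first Chern number is `B (2π)² / 2π = k`. -/
structure MagneticTorus (k : ℤ) where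
  A₁ : ℝ × ℝ → ℝ
  A₂ : ℝ × ℝ → ℝ
  χ₁ : ℝ × ℝ → ℝ
  χ₂ : ℝ × ℝ → ℝ
  smooth_A₁ : ContDiff ℝ ∞ A₁
  smooth_A₂ : ContDiff ℝ ∞ A₂
  smooth_χ₁ : ContDiff ℝ ∞ χ₁
  smooth_χ₂ : ContDiff ℝ ∞ χ₂
  /-- The two ways of translating by `(2π, 2π)` agree on sections. -/
  cocycle : ∀ x y : ℝ,
    Complex.exp (Complex.I * (χ₁ (x, y + 2 * π) + χ₂ (x, y) : ℝ)) =
      Complex.exp (Complex.I * (χ₂ (x + 2 * π, y) + χ₁ (x, y) : ℝ))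
  /-- The gauge potential changes by the gradient of the phase under each period. -/
  A₁_shift₁ : ∀ x y : ℝ, A₁ (x + 2 * π, y) = A₁ (x, y) + fderiv ℝ χ₁ (x, y) (1, 0)
  A₂_shift₁ : ∀ x y : ℝ, A₂ (x + 2 * π, y) = A₂ (x, y) + fderiv ℝ χ₁ (x, y) (0, 1)
  A₁_shift₂ : ∀ x y : ℝ, A₁ (x, y + 2 * π) = A₁ (x, y) + fderiv ℝ χ₂ (x, y) (1, 0)
  A₂_shift₂ : ∀ x y : ℝ, A₂ (x, y + 2 * π) = A₂ (x, y) + fderiv ℝ χ₂ (x, y) (0, 1)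
  /-- The curvature `∂₁A₂ - ∂₂A₁` is the constant `B = k / 2π`. -/
  curvature : ∀ p : ℝ × ℝ, fderiv ℝ A₂ p (1, 0) - fderiv ℝ A₁ p (0, 1) = (k : ℝ) / (2 * π)

namespace MagneticTorus

variable {k : ℤ} (M : MagneticTorus k)

/-- Holonomy of the connection along the circle `t ↦ (x, t)`, `0 ≤ t ≤ 2π`. The phase `χ₂` accounts
for the identification of the fibres over `(x, 0)` and `(x, 2π)`. -/
def holonomyα (x : ℝ) : ℂ :=
  Complex.exp (Complex.I * ((∫ t in (0 : ℝ)..2 * π, M.A₂ (x, t)) - M.χ₂ (x, 0) : ℝ))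

/-- Holonomy of the connection along the circle `t ↦ (t, y)`, `0 ≤ t ≤ 2π`. -/
def holonomyβ (y : ℝ) : ℂ :=
  Complex.exp (Complex.I * ((∫ t in (0 : ℝ)..2 * π, M.A₁ (t, y)) - M.χ₁ (0, y) : ℝ))

/-- Sections of the line bundle, as quasi-periodic functions on the plane. -/
def IsSection (ψ : ℝ × ℝ → ℂ) : Prop :=
  (∀ x y : ℝ, ψ (x + 2 * π, y) = Complex.exp (Complex.I * (M.χ₁ (x, y) : ℝ)) * ψ (x, y)) ∧
  (∀ x y : ℝ, ψ (x, y + 2 * π) = Complex.exp (Complex.I * (M.χ₂ (x, y) : ℝ)) * ψ (x, y))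

/-- Covariant derivative `∂₁ - i A₁`. -/
def D₁ (ψ : ℝ × ℝ → ℂ) (p : ℝ × ℝ) : ℂ :=
  fderiv ℝ ψ p (1, 0) - Complex.I * (M.A₁ p : ℝ) * ψ p

/-- Covariant derivative `∂₂ - i A₂`. -/
def D₂ (ψ : ℝ × ℝ → ℂ) (p : ℝ × ℝ) : ℂ :=
  fderiv ℝ ψ p (0, 1) - Complex.I * (M.A₂ p : ℝ) * ψ p

/-- The differential expression `H_A = -½ Δ_A + V`, where `Δ_A = D₁² + D₂²`. -/
def hamiltonian (V : ℝ × ℝ → ℝ) (ψ : ℝ × ℝ → ℂ) (p : ℝ × ℝ) : ℂ :=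
  -(1 / 2) * (M.D₁ (M.D₁ ψ) p + M.D₂ (M.D₂ ψ) p) + (V p : ℝ) * ψ p

end MagneticTorus

/-- Lebesgue measure on the fundamental domain `[0, 2π) × [0, 2π)`. -/
def torusMeasure : Measure (ℝ × ℝ) :=
  volume.restrict (Ico 0 (2 * π) ×ˢ Ico 0 (2 * π))

/-- The Hilbert space of states: square integrable sections. A section is determined by its
restriction to the fundamental domain. -/
abbrev StateSpace : Type := Lp ℂ 2 torusMeasure

namespace MagneticTorus

variable {k : ℤ} (M : MagneticTorus k) (V : ℝ × ℝ → ℝ)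

/-- Graph of `H_A` on the smooth sections, in the Hilbert space of states. -/
def smoothGraph : Set (StateSpace × StateSpace) :=
  {fg | ∃ u : ℝ × ℝ → ℂ, ContDiff ℝ ∞ u ∧ M.IsSection u ∧
    fg.1 =ᵐ[torusMeasure] u ∧ fg.2 =ᵐ[torusMeasure] M.hamiltonian V u}

/-- `S t = exp (-t H_A)` for `t ≥ 0`: `S` is the strongly continuous semigroup of bounded operators
on the space of states whose generator is `-H_A`, where `H_A` is the closure of the Hamiltonian on
smooth sections (which is its unique self-adjoint realization). -/
structure IsHeatSemigroup (S : ℝ → StateSpace →L[ℂ] StateSpace) : Prop where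
  zero : S 0 = ContinuousLinearMap.id ℂ StateSpace
  add : ∀ s t : ℝ, 0 ≤ s → 0 ≤ t → S (s + t) = (S s).comp (S t)
  strongly_continuous : ∀ f : StateSpace, Tendsto (fun t : ℝ => S t f) (𝓝[>] 0) (𝓝 f)
  generator : ∀ f g : StateSpace,
    Tendsto (fun t : ℝ => (t : ℂ)⁻¹ • (f - S t f)) (𝓝[>] 0) (𝓝 g) ↔
      (f, g) ∈ closure (M.smoothGraph V)

/-- `K T x y = ⟨x| exp (-T H_A) |y⟩` for `T > 0`: the continuous integral kernel of the heat
semigroup, a section of the line bundle in `x` and of its dual bundle in `y`. -/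
structure IsHeatKernel (K : ℝ → ℝ × ℝ → ℝ × ℝ → ℂ) : Prop where
  continuous : ∀ T : ℝ, 0 < T → Continuous (fun p : (ℝ × ℝ) × (ℝ × ℝ) => K T p.1 p.2)
  section_left : ∀ T : ℝ, 0 < T → ∀ y : ℝ × ℝ, M.IsSection (fun x => K T x y)
  section_right : ∀ T : ℝ, 0 < T → ∀ x : ℝ × ℝ,
    M.IsSection (fun y => (starRingEnd ℂ) (K T x y))
  kernel : ∃ S : ℝ → StateSpace →L[ℂ] StateSpace, M.IsHeatSemigroup V S ∧
    ∀ T : ℝ, 0 < T → ∀ f : StateSpace,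
      S T f =ᵐ[torusMeasure] fun x => ∫ y, K T x y * f y ∂torusMeasure

end MagneticTorus

end HallTorus

end

/-! The point reflection of the torus about `φ_{++}` lifts to a unitary involution `P` on sections
that commutes with `H_A`, and `P` acts on the fibres over its four fixed points by signs that are
not all equal.

A gauge function `Λ` brings the connection to Landau form `(0, x / 2π)` with constants `a`, `b`. The
two holonomies become `exp (i (x - b))` and `exp (-i (y + a))`, so `φ_{++} ≡ (b, -a)` modulo `2π`,
and the minus coordinates lie an odd multiple of `π` away. Reflection about `c` changes the Landau
potential by the gradient of `(c.1 / π) y`. The matching phase defines `parity`, which preserves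
sections when `c = φ_{++}` and commutes with the Hamiltonian because `V` is symmetric. On the fibre
over `c + π (m, n)` it is multiplication by `(-1)^(m n)`: `-1` at `φ_{--}` and `+1` at the other
three fixed points (`parity_apply_fixedPoint`).

Since `P` preserves the graph on smooth sections, `P S P` has the same generator as the heat
semigroup `S`, hence equals it (`IsC0Semigroup.eq_of_hasGenerator_iff`). The kernel is therefore
invariant under `P` acting on both arguments (`heatKernel_parity`), first almost everywhere and then
everywhere by continuity and quasi-periodicity. Between fibres of opposite sign this reads `K = -K`.
-/

noncomputable section

namespace HallTorus

open Real Set Filter Topology MeasureTheory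
open scoped ContDiff

/-! ### Strongly continuous semigroups and uniqueness from the generator -/

section Semigroup

variable {E : Type*} [NormedAddCommGroup E] [NormedSpace ℂ E]

/-- A strongly continuous one-parameter semigroup of bounded operators. -/
structure IsC0Semigroup (S : ℝ → E →L[ℂ] E) : Prop where
  zero : S 0 = ContinuousLinearMap.id ℂ E
  add : ∀ s t : ℝ, 0 ≤ s → 0 ≤ t → S (s + t) = (S s).comp (S t)
  strongly_continuous : ∀ f : E, Tendsto (fun t : ℝ => S t f) (𝓝[>] 0) (𝓝 f)

/-- `g = -G f`, where `G` is the infinitesimal generator of `S`. -/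
def HasGenerator (S : ℝ → E →L[ℂ] E) (f g : E) : Prop :=
  Tendsto (fun t : ℝ => (t : ℂ)⁻¹ • (f - S t f)) (𝓝[>] 0) (𝓝 g)

/-- Split `B i (v i) = B i v₀ + B i (v i - v₀)`: the uniform bound kills the second term, so
convergence of the operators is needed only at the vector `v₀`. -/
theorem tendsto_clm_apply_of_norm_le {ι : Type*} {l : Filter ι} {B : ι → E →L[ℂ] E} {v : ι → E}
    {v₀ u : E} {C : ℝ} (hB : ∀ᶠ i in l, ‖B i‖ ≤ C) (hv : Tendsto v l (𝓝 v₀))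
    (hu : Tendsto (fun i => B i v₀) l (𝓝 u)) : Tendsto (fun i => B i (v i)) l (𝓝 u) := by
  have h0 : Tendsto (fun i => B i (v i - v₀)) l (𝓝 0) := by
    have h1 : Tendsto (fun i => C * ‖v i - v₀‖) l (𝓝 0) := by
      have := ((hv.sub_const v₀).norm).const_mul C
      simpa using this
    refine squeeze_zero_norm' ?_ h1
    filter_upwards [hB] with i hi
    exact ((B i).le_opNorm _).trans (by gcongr)
  have := h0.add hu
  simpa using this

namespace IsC0Semigroup

variable {S S' : ℝ → E →L[ℂ] E}

theorem add_apply (hS : IsC0Semigroup S) {s t : ℝ} (hs : 0 ≤ s) (ht : 0 ≤ t) (f : E) :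
    S (s + t) f = S s (S t f) := by
  rw [hS.add s t hs ht]; rfl

theorem tendsto_zero (hS : IsC0Semigroup S) (f : E) :
    Tendsto (fun t : ℝ => S t f) (𝓝[≥] 0) (𝓝 f) := by
  have h : ContinuousWithinAt (fun t : ℝ => S t f) (Ioi 0) 0 := by
    simpa [ContinuousWithinAt, hS.zero] using hS.strongly_continuous f
  have h2 := continuousWithinAt_Ioi_iff_Ici.1 h
  simpa [ContinuousWithinAt, hS.zero] using h2

/-- Otherwise there are `t n → 0` with `‖S (t n)‖ > n`, although every orbit `S (t n) f` converges;
this contradicts Banach–Steinhaus. -/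
theorem exists_norm_le_near_zero [CompleteSpace E] (hS : IsC0Semigroup S) :
    ∃ δ > 0, ∃ C : ℝ, ∀ t, 0 ≤ t → t ≤ δ → ‖S t‖ ≤ C := by
  by_contra! hcon
  choose t ht0 ht1 ht2 using fun n : ℕ => hcon (1 / ((n : ℝ) + 1)) (by positivity) n
  have htend : Tendsto t atTop (𝓝[≥] 0) := by
    refine tendsto_nhdsWithin_iff.2 ⟨?_, Eventually.of_forall ht0⟩
    exact squeeze_zero ht0 ht1 tendsto_one_div_add_atTop_nhds_zero_nat
  obtain ⟨C, hC⟩ := banach_steinhaus (g := fun n => S (t n)) (fun f => by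
    have h := ((hS.tendsto_zero f).comp htend).norm
    obtain ⟨C, hC⟩ := h.bddAbove_range
    exact ⟨C, fun n => hC ⟨n, rfl⟩⟩)
  obtain ⟨n, hn⟩ := exists_nat_gt C
  linarith [ht2 n, hC n]

theorem exists_norm_le [CompleteSpace E] (hS : IsC0Semigroup S) (T : ℝ) :
    ∃ C : ℝ, ∀ t, 0 ≤ t → t ≤ T → ‖S t‖ ≤ C := by
  obtain ⟨δ, hδ, C₁, hC₁⟩ := hS.exists_norm_le_near_zero
  have key : ∀ n : ℕ, ∃ C : ℝ, ∀ t, 0 ≤ t → t ≤ (n + 1) * δ → ‖S t‖ ≤ C := by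
    intro n
    induction n with
    | zero => exact ⟨C₁, fun t h0 h1 => hC₁ t h0 (by simpa using h1)⟩
    | succ n ih =>
      obtain ⟨C, hC⟩ := ih
      have hC0 : 0 ≤ C := (norm_nonneg _).trans (hC 0 le_rfl (by positivity))
      refine ⟨max C (C * C₁), fun t h0 h1 => ?_⟩
      rcases le_or_gt t ((n + 1) * δ) with h | h
      · exact (hC t h0 h).trans (le_max_left _ _)
      · have hd : 0 ≤ t - (n + 1) * δ := by linarith
        have e : t = (n + 1) * δ + (t - (n + 1) * δ) := by ring
        rw [e, hS.add _ _ (by positivity) hd]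
        push_cast at h1
        refine ((S _).opNorm_comp_le _).trans ((mul_le_mul (hC _ (by positivity) le_rfl)
          (hC₁ _ hd (by linarith)) (norm_nonneg _) hC0).trans (le_max_right _ _))
  obtain ⟨n, hn⟩ := exists_nat_gt (T / δ)
  obtain ⟨C, hC⟩ := key n
  refine ⟨C, fun t h0 h1 => hC t h0 (h1.trans ?_)⟩
  rw [div_lt_iff₀ hδ] at hn
  linarith

theorem norm_sub_le (hS : IsC0Semigroup S) {C T s t : ℝ}
    (hC : ∀ t, 0 ≤ t → t ≤ T → ‖S t‖ ≤ C) (hs : 0 ≤ s) (hsT : s ≤ T) (ht : 0 ≤ t) (htT : t ≤ T)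
    (f : E) : ‖S t f - S s f‖ ≤ C * ‖S |t - s| f - f‖ := by
  wlog h : s ≤ t generalizing s t
  · have := this ht htT hs hsT (le_of_not_ge h)
    rwa [norm_sub_rev, abs_sub_comm]
  rw [abs_of_nonneg (sub_nonneg.2 h)]
  have e : S t f = S s (S (t - s) f) := by
    rw [← hS.add_apply hs (sub_nonneg.2 h)]; congr 2; ring
  rw [e, ← map_sub]
  exact ((S s).le_opNorm _).trans (by gcongr; exact hC s hs hsT)

theorem continuousOn [CompleteSpace E] (hS : IsC0Semigroup S) (f : E) :
    ContinuousOn (fun t => S t f) (Ici 0) := by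
  intro s hs
  obtain ⟨C, hC⟩ := hS.exists_norm_le (s + 1)
  have hlim : Tendsto (fun t => C * ‖S |t - s| f - f‖) (𝓝[Ici 0] s) (𝓝 0) := by
    have h1 : Tendsto (fun t => |t - s|) (𝓝[Ici 0] s) (𝓝[≥] 0) := by
      refine tendsto_nhdsWithin_iff.2 ⟨?_, Eventually.of_forall fun t => mem_Ici.2 (abs_nonneg _)⟩
      have : Continuous fun t : ℝ => |t - s| := by fun_prop
      simpa using (this.tendsto s).mono_left nhdsWithin_le_nhds
    have h2 := ((((hS.tendsto_zero f).comp h1).sub_const f).norm).const_mul C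
    simpa using h2
  rw [ContinuousWithinAt, tendsto_iff_norm_sub_tendsto_zero]
  refine squeeze_zero' (Eventually.of_forall fun t => norm_nonneg _) ?_ hlim
  filter_upwards [self_mem_nhdsWithin,
    mem_nhdsWithin_of_mem_nhds (Iic_mem_nhds (lt_add_one s))] with t ht0 ht1
  exact hS.norm_sub_le hC hs (by linarith) ht0 ht1 f

theorem hasGenerator_apply (hS : IsC0Semigroup S) {f g : E} (h : HasGenerator S f g) {s : ℝ}
    (hs : 0 ≤ s) : HasGenerator S (S s f) (S s g) := by
  have h1 := ((S s).continuous.tendsto g).comp h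
  refine h1.congr' ?_
  filter_upwards [self_mem_nhdsWithin] with t ht
  have : S s (S t f) = S t (S s f) := by
    rw [← hS.add_apply hs (le_of_lt ht), add_comm, hS.add_apply (le_of_lt ht) hs]
  simp [map_smul, map_sub, this]

theorem intervalIntegrable [CompleteSpace E] (hS : IsC0Semigroup S) (f : E) {a b : ℝ}
    (ha : 0 ≤ a) (hb : 0 ≤ b) : IntervalIntegrable (fun t => S t f) volume a b :=
  ((hS.continuousOn f).mono fun _ ht => (le_min ha hb).trans ht.1).intervalIntegrable

theorem tendsto_average_right [CompleteSpace E] (hS : IsC0Semigroup S) (f : E) {a : ℝ}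
    (ha : 0 ≤ a) :
    Tendsto (fun r : ℝ => (r : ℂ)⁻¹ • ∫ t in a..(a + r), S t f) (𝓝[>] 0) (𝓝 (S a f)) := by
  have hc : ContinuousWithinAt (fun t => S t f) (Ici a) a :=
    (hS.continuousOn f a ha).mono (Ici_subset_Ici.2 ha)
  have hm : StronglyMeasurableAtFilter (fun t => S t f) (𝓝[>] a) volume :=
    ⟨Ici a, mem_of_superset self_mem_nhdsWithin Ioi_subset_Ici_self,
      ((hS.continuousOn f).mono (Ici_subset_Ici.2 ha)).aestronglyMeasurable measurableSet_Ici⟩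
  have hd : HasDerivWithinAt (fun u => ∫ t in a..u, S t f) (S a f) (Ici a) a :=
    intervalIntegral.integral_hasDerivWithinAt_right (by simp) hm
      (hc.mono Ioi_subset_Ici_self)
  rw [← hasDerivWithinAt_Ioi_iff_Ici, hasDerivWithinAt_iff_tendsto_slope' (by simp)] at hd
  have hshift : Tendsto (fun r : ℝ => a + r) (𝓝[>] 0) (𝓝[>] a) := by
    refine tendsto_nhdsWithin_iff.2 ⟨?_, ?_⟩
    · have : Continuous fun r : ℝ => a + r := by fun_prop
      simpa using (this.tendsto 0).mono_left nhdsWithin_le_nhds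
    · filter_upwards [self_mem_nhdsWithin] with r hr
      simpa using hr
  refine (hd.comp hshift).congr fun r => ?_
  simp [slope, ← Complex.ofReal_inv]

/-- Applying `S r` shifts the interval of integration by `r`, so in the difference only two end
pieces of length `r` survive; their averages tend to `f` and `S h f`. -/
theorem hasGenerator_integral [CompleteSpace E] (hS : IsC0Semigroup S) (f : E) {h : ℝ}
    (hh : 0 ≤ h) : HasGenerator S (∫ t in (0 : ℝ)..h, S t f) (f - S h f) := by
  have h1 := (hS.tendsto_average_right f le_rfl).sub (hS.tendsto_average_right f hh)
  rw [hS.zero] at h1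
  refine Tendsto.congr' ?_ h1
  filter_upwards [self_mem_nhdsWithin] with r hr
  have hr : 0 ≤ r := le_of_lt hr
  have e1 : S r (∫ t in (0 : ℝ)..h, S t f) = ∫ t in r..(h + r), S t f := by
    rw [← ContinuousLinearMap.intervalIntegral_comp_comm _ (hS.intervalIntegrable f le_rfl hh)]
    have : ∫ t in (0 : ℝ)..h, S r (S t f) = ∫ t in (0 : ℝ)..h, S (t + r) f := by
      refine intervalIntegral.integral_congr fun t ht => ?_
      rw [uIcc_of_le hh] at ht
      rw [add_comm, hS.add_apply hr ht.1]
    rw [this, intervalIntegral.integral_comp_add_right (fun t => S t f), zero_add]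
  rw [e1, ← smul_sub, zero_add]
  congr 1
  have i1 := intervalIntegral.integral_add_adjacent_intervals
    (hS.intervalIntegrable f le_rfl hh) (hS.intervalIntegrable f hh (add_nonneg hh hr))
  have i2 := intervalIntegral.integral_add_adjacent_intervals
    (hS.intervalIntegrable f le_rfl hr) (hS.intervalIntegrable f hr (add_nonneg hh hr))
  rw [← i2] at i1
  exact sub_eq_sub_iff_add_eq_add.2 (by rw [i1])

/-- The averages `r⁻¹ ∫₀ʳ S t f` lie in the domain and tend to `f`. -/
theorem dense_domain [CompleteSpace E] (hS : IsC0Semigroup S) :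
    Dense {f : E | ∃ g, HasGenerator S f g} := by
  intro f
  have h := hS.tendsto_average_right f le_rfl
  rw [hS.zero] at h
  refine mem_closure_of_tendsto h ?_
  filter_upwards [self_mem_nhdsWithin] with r hr
  have := (hS.hasGenerator_integral f (le_of_lt hr)).const_smul (r : ℂ)⁻¹
  refine ⟨(r : ℂ)⁻¹ • (f - S r f), this.congr fun t => ?_⟩
  rw [zero_add, map_smul, ← smul_sub, smul_comm]

/-- The increment from `s` to `r` is `S (t - r)` applied to `(S' (r - s) - S (r - s)) (S' s f)`.
Both difference quotients have the limit `-g`, and the norms of `S (t - r)` stay bounded. -/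
theorem hasDerivWithinAt_comp (hS : IsC0Semigroup S) (hS' : IsC0Semigroup S') {C t s : ℝ}
    (hC : ∀ r, 0 ≤ r → r ≤ t → ‖S r‖ ≤ C) (hs : 0 ≤ s) (hst : s < t) {f g : E}
    (h : HasGenerator S (S' s f) g) (h' : HasGenerator S' (S' s f) g) :
    HasDerivWithinAt (fun r => S (t - r) (S' r f)) 0 (Ici s) s := by
  rw [← hasDerivWithinAt_Ioi_iff_Ici, hasDerivWithinAt_iff_tendsto_slope' (by simp)]
  have hshift : Tendsto (fun r : ℝ => r - s) (𝓝[>] s) (𝓝[>] 0) := by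
    refine tendsto_nhdsWithin_iff.2 ⟨?_, ?_⟩
    · have : Continuous fun r : ℝ => r - s := by fun_prop
      simpa using (this.tendsto s).mono_left nhdsWithin_le_nhds
    · filter_upwards [self_mem_nhdsWithin] with r hr
      simpa using hr
  have h0 := (h.sub h').comp hshift
  rw [sub_self] at h0
  have hmem : ∀ᶠ r in 𝓝[>] s, r ≤ t := mem_nhdsWithin_of_mem_nhds (Iic_mem_nhds hst)
  have hB : ∀ᶠ r in 𝓝[>] s, ‖S (t - r)‖ ≤ C := by
    filter_upwards [self_mem_nhdsWithin, hmem] with r hr hrt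
    exact hC _ (sub_nonneg.2 hrt) (by linarith [mem_Ioi.1 hr])
  have h1 := tendsto_clm_apply_of_norm_le hB h0 (u := 0) (by simp)
  refine h1.congr' ?_
  filter_upwards [self_mem_nhdsWithin, hmem] with r hr hrt
  have hrs : 0 ≤ r - s := by linarith [mem_Ioi.1 hr]
  have e1 : S' r f = S' (r - s) (S' s f) := by
    rw [← hS'.add_apply hrs hs]; congr 2; ring
  have e2 : S (t - s) (S' s f) = S (t - r) (S (r - s) (S' s f)) := by
    rw [← hS.add_apply (sub_nonneg.2 hrt) hrs]; congr 2; ring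
  simp only [slope, vsub_eq_sub, Function.comp_apply, e1, e2]
  rw [← smul_sub, sub_sub_sub_cancel_left, map_smul, map_sub, ← Complex.ofReal_inv,
    Complex.coe_smul]

theorem continuousOn_comp [CompleteSpace E] (hS : IsC0Semigroup S) (hS' : IsC0Semigroup S')
    (t : ℝ) (f : E) : ContinuousOn (fun r => S (t - r) (S' r f)) (Icc 0 t) := by
  intro s hs
  obtain ⟨C, hC⟩ := hS.exists_norm_le t
  refine tendsto_clm_apply_of_norm_le (C := C) ?_
    ((hS'.continuousOn f s hs.1).mono Icc_subset_Ici_self) ?_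
  · filter_upwards [self_mem_nhdsWithin] with r hr
    exact hC _ (sub_nonneg.2 hr.2) (by linarith [hr.1])
  · have := (hS.continuousOn (S' s f)).comp (f := fun r : ℝ => t - r) (s := Icc 0 t)
      (by fun_prop) (fun r hr => sub_nonneg.2 hr.2)
    exact this s hs

/-- A strongly continuous semigroup is determined by its generator. -/
theorem eq_of_hasGenerator_iff [CompleteSpace E] (hS : IsC0Semigroup S) (hS' : IsC0Semigroup S')
    (h : ∀ f g, HasGenerator S f g ↔ HasGenerator S' f g) {t : ℝ} (ht : 0 ≤ t) :
    S t = S' t := by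
  obtain ⟨C, hC⟩ := hS.exists_norm_le t
  refine ContinuousLinearMap.coeFn_injective
    (Continuous.ext_on hS.dense_domain (S t).continuous (S' t).continuous ?_)
  rintro f ⟨g, hg⟩
  -- The path `r ↦ S (t - r) (S' r f)` joins `S t f` to `S' t f` and has zero right derivative.
  have := constant_of_has_deriv_right_zero (hS.continuousOn_comp hS' t f) (fun s hs => by
    have h' := hS'.hasGenerator_apply ((h f g).1 hg) hs.1
    exact hS.hasDerivWithinAt_comp hS' hC hs.1 hs.2 ((h _ _).2 h') h') t ⟨ht, le_rfl⟩
  simpa [hS.zero, hS'.zero] using this.symm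

end IsC0Semigroup

end Semigroup

/-! ### Gauge transformation to the Landau gauge -/

theorem exp_I_mul_eq_of_sub_eq {u v : ℝ} (n : ℤ) (h : u - v = n * (2 * π)) :
    Complex.exp (Complex.I * (u : ℝ)) = Complex.exp (Complex.I * (v : ℝ)) := by
  rw [Complex.exp_eq_exp_iff_exists_int]
  refine ⟨n, ?_⟩
  have : u = v + n * (2 * π) := by linarith
  rw [this]; push_cast; ring

theorem eq_add_const_of_fderiv_eq {f : ℝ × ℝ → ℝ} (hf : Differentiable ℝ f) {u v : ℝ}
    (h₁ : ∀ p, fderiv ℝ f p (1, 0) = u) (h₂ : ∀ p, fderiv ℝ f p (0, 1) = v) (p : ℝ × ℝ) :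
    f p = f 0 + u * p.1 + v * p.2 := by
  let L : ℝ × ℝ →L[ℝ] ℝ :=
    u • ContinuousLinearMap.fst ℝ ℝ ℝ + v • ContinuousLinearMap.snd ℝ ℝ ℝ
  have hd : ∀ q, fderiv ℝ (fun q => f q - L q) q = 0 := by
    intro q
    rw [fderiv_fun_sub (hf q) L.differentiableAt, ContinuousLinearMap.fderiv]
    ext <;> simp [L, h₁, h₂]
  have := is_const_of_fderiv_eq_zero (hf.sub L.differentiable) hd p 0
  simp [L] at this
  linarith

namespace MagneticTorus

/-- `Λ` is a gauge transformation to the Landau gauge `A = (0, x / 2π)`, in which sections satisfy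
`ψ (x + 2π, y) = exp (i (y + a)) ψ (x, y)` and `ψ (x, y + 2π) = exp (i b) ψ (x, y)`. -/
structure IsLandauGauge (M : MagneticTorus 1) (Λ : ℝ × ℝ → ℝ) (a b : ℝ) : Prop where
  smooth : ContDiff ℝ ∞ Λ
  fderiv_fst : ∀ p, fderiv ℝ Λ p (1, 0) = M.A₁ p
  fderiv_snd : ∀ p, fderiv ℝ Λ p (0, 1) = M.A₂ p - p.1 / (2 * π)
  shift_fst : ∀ x y, Λ (x + 2 * π, y) = Λ (x, y) + M.χ₁ (x, y) - (y + a)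
  shift_snd : ∀ x y, Λ (x, y + 2 * π) = Λ (x, y) + M.χ₂ (x, y) - b

/-- The form `A₁ dx + (A₂ - x / 2π) dy` is closed, because both potentials have curvature `1 / 2π`;
the Poincaré lemma applies on the plane. -/
theorem exists_primitive (M : MagneticTorus 1) :
    ∃ Λ : ℝ × ℝ → ℝ, ContDiff ℝ ∞ Λ ∧ (∀ p, fderiv ℝ Λ p (1, 0) = M.A₁ p) ∧
      ∀ p, fderiv ℝ Λ p (0, 1) = M.A₂ p - p.1 / (2 * π) := by
  let η : ℝ × ℝ → ℝ × ℝ →L[ℝ] ℝ := fun p =>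
    M.A₁ p • ContinuousLinearMap.fst ℝ ℝ ℝ +
      (M.A₂ p - p.1 / (2 * π)) • ContinuousLinearMap.snd ℝ ℝ ℝ
  have hA₁ := M.smooth_A₁
  have hA₂ := M.smooth_A₂
  have hη : ContDiff ℝ ∞ η := by fun_prop
  have hA₁d : Differentiable ℝ M.A₁ := hA₁.differentiable (by simp)
  have hA₂d : Differentiable ℝ M.A₂ := hA₂.differentiable (by simp)
  have hdη : ∀ p, HasFDerivAt η
      ((fderiv ℝ M.A₁ p).smulRight (ContinuousLinearMap.fst ℝ ℝ ℝ) +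
        (fderiv ℝ M.A₂ p - (2 * π)⁻¹ • ContinuousLinearMap.fst ℝ ℝ ℝ).smulRight
          (ContinuousLinearMap.snd ℝ ℝ ℝ)) p := by
    intro p
    have h1 := (hA₁d p).hasFDerivAt
    have h2 := (hA₂d p).hasFDerivAt.sub ((hasFDerivAt_fst (𝕜 := ℝ) (p := p)).const_smul (2 * π)⁻¹)
    have h := (h1.smul_const (ContinuousLinearMap.fst ℝ ℝ ℝ)).add
      (h2.smul_const (ContinuousLinearMap.snd ℝ ℝ ℝ))
    refine h.congr_of_eventuallyEq (Eventually.of_forall fun q => ?_)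
    simp [η, div_eq_inv_mul]
  have hdec : ∀ (L : ℝ × ℝ →L[ℝ] ℝ) (u : ℝ × ℝ), L u = u.1 * L (1, 0) + u.2 * L (0, 1) := by
    intro L u
    have : u = u.1 • ((1 : ℝ), (0 : ℝ)) + u.2 • ((0 : ℝ), (1 : ℝ)) := by ext <;> simp
    conv_lhs => rw [this, map_add, map_smul, map_smul, smul_eq_mul, smul_eq_mul]
  obtain ⟨Λ, hΛ⟩ := convex_univ.exists_forall_hasFDerivAt_of_fderiv_symmetric isOpen_univ
    (hη.differentiable (by simp)).differentiableOn (fun p _ u v => by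
      have hc := M.curvature p
      rw [(hdη p).fderiv]
      simp only [_root_.add_apply, ContinuousLinearMap.smulRight_apply,
        _root_.sub_apply, _root_.smul_apply,
        ContinuousLinearMap.coe_fst', ContinuousLinearMap.coe_snd', smul_eq_mul]
      rw [hdec (fderiv ℝ M.A₁ p) u, hdec (fderiv ℝ M.A₁ p) v, hdec (fderiv ℝ M.A₂ p) u,
        hdec (fderiv ℝ M.A₂ p) v]
      rw [Int.cast_one, one_div] at hc
      linear_combination (u.1 * v.2 - u.2 * v.1) * hc)
  have hf : fderiv ℝ Λ = η := funext fun p => (hΛ p (mem_univ p)).fderiv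
  refine ⟨Λ, contDiff_infty_iff_fderiv.2
    ⟨fun p => (hΛ p (mem_univ p)).differentiableAt, hf ▸ hη⟩, fun p => ?_, fun p => ?_⟩ <;>
  simp [hf, η]

/-- The defect `Λ (q + period) - Λ q - χ q` has constant gradient: `(0, -1)` for the first period,
where `x / 2π` grows by `1`, and `0` for the second. The constants `a` and `b` are minus its values
at the origin. -/
theorem exists_isLandauGauge (M : MagneticTorus 1) : ∃ Λ a b, M.IsLandauGauge Λ a b := by
  obtain ⟨Λ, hΛ, h₁, h₂⟩ := M.exists_primitive
  have hΛd : Differentiable ℝ Λ := hΛ.differentiable (by simp)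
  have hχ₁ : Differentiable ℝ M.χ₁ := M.smooth_χ₁.differentiable (by simp)
  have hχ₂ : Differentiable ℝ M.χ₂ := M.smooth_χ₂.differentiable (by simp)
  have hder : ∀ (χ : ℝ × ℝ → ℝ), Differentiable ℝ χ → ∀ c p v,
      fderiv ℝ (fun q => Λ (q + c) - Λ q - χ q) p v =
        fderiv ℝ Λ (p + c) v - fderiv ℝ Λ p v - fderiv ℝ χ p v := by
    intro χ hχ c p v
    have hc : DifferentiableAt ℝ (fun q => Λ (q + c)) p := by fun_prop
    have hc' : DifferentiableAt ℝ (fun q => Λ (q + c) - Λ q) p := by fun_prop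
    rw [fderiv_fun_sub hc' (hχ p), fderiv_fun_sub hc (hΛd p), fderiv_comp_add_right]
    rfl
  have e₁ := eq_add_const_of_fderiv_eq (f := fun q => Λ (q + (2 * π, 0)) - Λ q - M.χ₁ q)
    (u := 0) (v := -1) (by fun_prop)
    (fun p => by
      rw [hder _ hχ₁, h₁, h₁]
      have := M.A₁_shift₁ p.1 p.2
      simp only [Prod.mk.eta] at this
      simp only [Prod.add_def, add_zero, this]; ring)
    (fun p => by
      rw [hder _ hχ₁, h₂, h₂]
      have := M.A₂_shift₁ p.1 p.2
      simp only [Prod.mk.eta] at this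
      simp only [Prod.add_def, add_zero, this]; field_simp; ring)
  have e₂ := eq_add_const_of_fderiv_eq (f := fun q => Λ (q + (0, 2 * π)) - Λ q - M.χ₂ q)
    (u := 0) (v := 0) (by fun_prop)
    (fun p => by
      rw [hder _ hχ₂, h₁, h₁]
      have := M.A₁_shift₂ p.1 p.2
      simp only [Prod.mk.eta] at this
      simp only [Prod.add_def, add_zero, this]; ring)
    (fun p => by
      rw [hder _ hχ₂, h₂, h₂]
      have := M.A₂_shift₂ p.1 p.2
      simp only [Prod.mk.eta] at this
      simp only [Prod.add_def, add_zero, this]; ring)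
  refine ⟨Λ, -(Λ (0 + (2 * π, 0)) - Λ 0 - M.χ₁ 0), -(Λ (0 + (0, 2 * π)) - Λ 0 - M.χ₂ 0),
    hΛ, h₁, h₂, fun x y => ?_, fun x y => ?_⟩
  · have := e₁ (x, y)
    simp only [Prod.mk_add_mk, add_zero] at this ⊢
    linarith
  · have := e₂ (x, y)
    simp only [Prod.mk_add_mk, add_zero] at this ⊢
    linarith

namespace IsLandauGauge

variable {M : MagneticTorus 1} {Λ : ℝ × ℝ → ℝ} {a b : ℝ}

theorem differentiable (h : M.IsLandauGauge Λ a b) : Differentiable ℝ Λ :=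
  h.smooth.differentiable (by simp)

/-- The integrand `A₂ (x, t)` is the derivative of `Λ (x, t) + x t / 2π`, and the increment of `Λ`
over a period cancels `χ₂` up to `b`. The holonomy thus determines `x` modulo `2π`. -/
theorem holonomyα_eq (h : M.IsLandauGauge Λ a b) (x : ℝ) :
    M.holonomyα x = Complex.exp (Complex.I * (x - b : ℝ)) := by
  have hA : Continuous M.A₂ := M.smooth_A₂.continuous
  have hd : ∀ t : ℝ, HasDerivAt (fun t => Λ (x, t) + x / (2 * π) * t) (M.A₂ (x, t)) t := by
    intro t
    have h1 := (h.differentiable (x, t)).hasFDerivAt.comp_hasDerivAt t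
      ((hasDerivAt_const t x).prodMk (hasDerivAt_id t))
    rw [h.fderiv_snd] at h1
    have h2 := h1.add ((hasDerivAt_id t).const_mul (x / (2 * π)))
    convert! h2 using 1
    simp
  have hint := intervalIntegral.integral_eq_sub_of_hasDerivAt (a := 0) (b := 2 * π)
    (fun t _ => hd t) ((by fun_prop : Continuous fun t => M.A₂ (x, t)).intervalIntegrable _ _)
  have hs := h.shift_snd x 0
  rw [zero_add] at hs
  have hx : x / (2 * π) * (2 * π) = x := by field_simp
  rw [holonomyα, hint, hs, hx]
  congr 3
  ring

theorem holonomyβ_eq (h : M.IsLandauGauge Λ a b) (y : ℝ) :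
    M.holonomyβ y = Complex.exp (Complex.I * (-(y + a) : ℝ)) := by
  have hA : Continuous M.A₁ := M.smooth_A₁.continuous
  have hd : ∀ t : ℝ, HasDerivAt (fun t => Λ (t, y)) (M.A₁ (t, y)) t := by
    intro t
    have h1 := (h.differentiable (t, y)).hasFDerivAt.comp_hasDerivAt t
      ((hasDerivAt_id t).prodMk (hasDerivAt_const t y))
    rw [h.fderiv_fst] at h1
    exact h1
  have hint := intervalIntegral.integral_eq_sub_of_hasDerivAt (a := 0) (b := 2 * π)
    (fun t _ => hd t) ((by fun_prop : Continuous fun t => M.A₁ (t, y)).intervalIntegrable _ _)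
  have hs := h.shift_fst 0 y
  rw [zero_add] at hs
  rw [holonomyβ, hint, hs]
  congr 3
  ring

theorem section_shift_fst (h : M.IsLandauGauge Λ a b) {ψ : ℝ × ℝ → ℂ} (hψ : M.IsSection ψ)
    (m : ℤ) (x y : ℝ) : ψ (x + m * (2 * π), y) =
      Complex.exp (Complex.I * (Λ (x + m * (2 * π), y) - Λ (x, y) + m * (y + a) : ℝ)) *
        ψ (x, y) := by
  have step : ∀ x, ψ (x + 2 * π, y) =
      Complex.exp (Complex.I * (Λ (x + 2 * π, y) - Λ (x, y) + (y + a) : ℝ)) * ψ (x, y) := by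
    intro x
    rw [hψ.1, h.shift_fst]
    congr 4; ring
  induction m using Int.induction_on with
  | zero => simp
  | succ n ih =>
    have e : x + ((n : ℤ) + 1 : ℤ) * (2 * π) = x + (n : ℤ) * (2 * π) + 2 * π := by
      push_cast; ring
    rw [e, step, ih, ← mul_assoc (Complex.exp _), ← Complex.exp_add]
    congr 2; push_cast; ring
  | pred n ih =>
    have e : x + (-(n : ℤ) : ℤ) * (2 * π) = x + (-(n : ℤ) - 1 : ℤ) * (2 * π) + 2 * π := by
      push_cast; ring
    rw [e, step] at ih
    rw [← mul_right_inj' (Complex.exp_ne_zero _), ih, ← mul_assoc (Complex.exp _), ← Complex.exp_add]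
    congr 2; push_cast; ring

theorem section_shift_snd (h : M.IsLandauGauge Λ a b) {ψ : ℝ × ℝ → ℂ} (hψ : M.IsSection ψ)
    (n : ℤ) (x y : ℝ) : ψ (x, y + n * (2 * π)) =
      Complex.exp (Complex.I * (Λ (x, y + n * (2 * π)) - Λ (x, y) + n * b : ℝ)) *
        ψ (x, y) := by
  have step : ∀ y, ψ (x, y + 2 * π) =
      Complex.exp (Complex.I * (Λ (x, y + 2 * π) - Λ (x, y) + b : ℝ)) * ψ (x, y) := by
    intro y
    rw [hψ.2, h.shift_snd]
    congr 4; ring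
  induction n using Int.induction_on with
  | zero => simp
  | succ n ih =>
    have e : y + ((n : ℤ) + 1 : ℤ) * (2 * π) = y + (n : ℤ) * (2 * π) + 2 * π := by
      push_cast; ring
    rw [e, step, ih, ← mul_assoc (Complex.exp _), ← Complex.exp_add]
    congr 2; push_cast; ring
  | pred n ih =>
    have e : y + (-(n : ℤ) : ℤ) * (2 * π) = y + (-(n : ℤ) - 1 : ℤ) * (2 * π) + 2 * π := by
      push_cast; ring
    rw [e, step] at ih
    rw [← mul_right_inj' (Complex.exp_ne_zero _), ih, ← mul_assoc (Complex.exp _), ← Complex.exp_add]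
    congr 2; push_cast; ring

/-- The horizontal translation is taken at height `y`; translating vertically first would change the
exponent by `2π m n`, which is invisible to the exponential. -/
theorem section_shift (h : M.IsLandauGauge Λ a b) {ψ : ℝ × ℝ → ℂ} (hψ : M.IsSection ψ)
    (m n : ℤ) (x y : ℝ) : ψ (x + m * (2 * π), y + n * (2 * π)) =
      Complex.exp (Complex.I * (Λ (x + m * (2 * π), y + n * (2 * π)) - Λ (x, y) +
        m * (y + a) + n * b : ℝ)) * ψ (x, y) := by
  rw [h.section_shift_snd hψ, h.section_shift_fst hψ, ← mul_assoc, ← Complex.exp_add]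
  congr 2; push_cast; ring

end IsLandauGauge

end MagneticTorus

/-! ### Covariant derivatives and the Hamiltonian preserve sections -/

theorem fderiv_exp_I_mul_mul {χ : ℝ × ℝ → ℝ} {φ : ℝ × ℝ → ℂ} {p : ℝ × ℝ}
    (hχ : DifferentiableAt ℝ χ p) (hφ : DifferentiableAt ℝ φ p) (v : ℝ × ℝ) :
    fderiv ℝ (fun q => Complex.exp (Complex.I * (χ q : ℝ)) * φ q) p v =
      Complex.exp (Complex.I * (χ p : ℝ)) *
        (Complex.I * (fderiv ℝ χ p v : ℝ) * φ p + fderiv ℝ φ p v) := by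
  have h1 : HasFDerivAt (fun q => ((χ q : ℝ) : ℂ)) (Complex.ofRealCLM.comp (fderiv ℝ χ p)) p :=
    Complex.ofRealCLM.hasFDerivAt.comp p hχ.hasFDerivAt
  have h2 := ((h1.const_mul Complex.I).cexp).mul hφ.hasFDerivAt
  change HasFDerivAt (fun q => Complex.exp (Complex.I * (χ q : ℝ)) * φ q) _ p at h2
  rw [h2.fderiv]
  simp
  ring

namespace MagneticTorus

variable {k : ℤ} {M : MagneticTorus k}

theorem smooth_D₁ {ψ : ℝ × ℝ → ℂ} (hψ : ContDiff ℝ ∞ ψ) : ContDiff ℝ ∞ (M.D₁ ψ) := by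
  have h1 : ContDiff ℝ ∞ (fun p => fderiv ℝ ψ p (1, 0)) :=
    (hψ.fderiv_right (by simp)).clm_apply contDiff_const
  have h2 : ContDiff ℝ ∞ (fun p => ((M.A₁ p : ℝ) : ℂ)) :=
    Complex.ofRealCLM.contDiff.comp M.smooth_A₁
  exact h1.sub ((contDiff_const.mul h2).mul hψ)

theorem smooth_D₂ {ψ : ℝ × ℝ → ℂ} (hψ : ContDiff ℝ ∞ ψ) : ContDiff ℝ ∞ (M.D₂ ψ) := by
  have h1 : ContDiff ℝ ∞ (fun p => fderiv ℝ ψ p (0, 1)) :=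
    (hψ.fderiv_right (by simp)).clm_apply contDiff_const
  have h2 : ContDiff ℝ ∞ (fun p => ((M.A₂ p : ℝ) : ℂ)) :=
    Complex.ofRealCLM.contDiff.comp M.smooth_A₂
  exact h1.sub ((contDiff_const.mul h2).mul hψ)

theorem fderiv_shift {ψ : ℝ × ℝ → ℂ} {χ : ℝ × ℝ → ℝ} (hψ : Differentiable ℝ ψ)
    (hχ : Differentiable ℝ χ) {c : ℝ × ℝ}
    (h : ∀ q, ψ (q + c) = Complex.exp (Complex.I * (χ q : ℝ)) * ψ q) (p v : ℝ × ℝ) :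
    fderiv ℝ ψ (p + c) v = Complex.exp (Complex.I * (χ p : ℝ)) *
        (Complex.I * (fderiv ℝ χ p v : ℝ) * ψ p + fderiv ℝ ψ p v) := by
  rw [← fderiv_comp_add_right, funext h, fderiv_exp_I_mul_mul (hχ p) (hψ p)]

theorem IsSection.shift_fst {ψ : ℝ × ℝ → ℂ} (h : M.IsSection ψ) (q : ℝ × ℝ) :
    ψ (q + (2 * π, 0)) = Complex.exp (Complex.I * (M.χ₁ q : ℝ)) * ψ q := by
  simpa [Prod.add_def] using h.1 q.1 q.2

theorem IsSection.shift_snd {ψ : ℝ × ℝ → ℂ} (h : M.IsSection ψ) (q : ℝ × ℝ) :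
    ψ (q + (0, 2 * π)) = Complex.exp (Complex.I * (M.χ₂ q : ℝ)) * ψ q := by
  simpa [Prod.add_def] using h.2 q.1 q.2

/-- Gauge covariance: differentiating the transition phase produces a term that the shift of the
potential cancels. -/
theorem IsSection.D₁ {ψ : ℝ × ℝ → ℂ} (h : M.IsSection ψ) (hψ : Differentiable ℝ ψ) :
    M.IsSection (M.D₁ ψ) := by
  have hχ₁ : Differentiable ℝ M.χ₁ := M.smooth_χ₁.differentiable (by simp)
  have hχ₂ : Differentiable ℝ M.χ₂ := M.smooth_χ₂.differentiable (by simp)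
  constructor
  · intro x y
    have h1 := fderiv_shift hψ hχ₁ h.shift_fst (x, y) (1, 0)
    rw [Prod.mk_add_mk, add_zero] at h1
    rw [MagneticTorus.D₁, MagneticTorus.D₁, h1, h.1, M.A₁_shift₁]
    push_cast; ring
  · intro x y
    have h1 := fderiv_shift hψ hχ₂ h.shift_snd (x, y) (1, 0)
    rw [Prod.mk_add_mk, add_zero] at h1
    rw [MagneticTorus.D₁, MagneticTorus.D₁, h1, h.2, M.A₁_shift₂]
    push_cast; ring

theorem IsSection.D₂ {ψ : ℝ × ℝ → ℂ} (h : M.IsSection ψ) (hψ : Differentiable ℝ ψ) :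
    M.IsSection (M.D₂ ψ) := by
  have hχ₁ : Differentiable ℝ M.χ₁ := M.smooth_χ₁.differentiable (by simp)
  have hχ₂ : Differentiable ℝ M.χ₂ := M.smooth_χ₂.differentiable (by simp)
  constructor
  · intro x y
    have h1 := fderiv_shift hψ hχ₁ h.shift_fst (x, y) (0, 1)
    rw [Prod.mk_add_mk, add_zero] at h1
    rw [MagneticTorus.D₂, MagneticTorus.D₂, h1, h.1, M.A₂_shift₁]
    push_cast; ring
  · intro x y
    have h1 := fderiv_shift hψ hχ₂ h.shift_snd (x, y) (0, 1)
    rw [Prod.mk_add_mk, add_zero] at h1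
    rw [MagneticTorus.D₂, MagneticTorus.D₂, h1, h.2, M.A₂_shift₂]
    push_cast; ring

theorem IsSection.hamiltonian {V : ℝ × ℝ → ℝ} (hV₁ : ∀ x y : ℝ, V (x + 2 * π, y) = V (x, y))
    (hV₂ : ∀ x y : ℝ, V (x, y + 2 * π) = V (x, y)) {ψ : ℝ × ℝ → ℂ} (h : M.IsSection ψ)
    (hψ : ContDiff ℝ ∞ ψ) : M.IsSection (M.hamiltonian V ψ) := by
  have hd {φ : ℝ × ℝ → ℂ} (hφ : ContDiff ℝ ∞ φ) : Differentiable ℝ φ :=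
    hφ.differentiable (by simp)
  have h11 := (h.D₁ (hd hψ)).D₁ (hd (smooth_D₁ hψ))
  have h22 := (h.D₂ (hd hψ)).D₂ (hd (smooth_D₂ hψ))
  constructor
  · intro x y
    rw [MagneticTorus.hamiltonian, MagneticTorus.hamiltonian, h11.1, h22.1, h.1, hV₁]; ring
  · intro x y
    rw [MagneticTorus.hamiltonian, MagneticTorus.hamiltonian, h11.2, h22.2, h.2, hV₂]; ring

end MagneticTorus

/-! ### The reflection and its lift to the line bundle -/

/-- The point reflection of the plane about `c`. -/
def reflection (c p : ℝ × ℝ) : ℝ × ℝ := (2 * c.1 - p.1, 2 * c.2 - p.2)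

theorem reflection_eq (c p : ℝ × ℝ) : reflection c p = (2 : ℝ) • c - p := by
  simp [reflection, Prod.sub_def]

theorem smooth_reflection (c : ℝ × ℝ) : ContDiff ℝ ∞ (reflection c) := by
  rw [show reflection c = fun p => (2 : ℝ) • c - p from funext (reflection_eq c)]
  fun_prop

theorem fderiv_comp_reflection {F : Type*} [NormedAddCommGroup F] [NormedSpace ℝ F]
    {f : ℝ × ℝ → F} (hf : Differentiable ℝ f) (c p v : ℝ × ℝ) :
    fderiv ℝ (fun q => f (reflection c q)) p v = -fderiv ℝ f (reflection c p) v := by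
  have hR : HasFDerivAt (reflection c) (-ContinuousLinearMap.id ℝ (ℝ × ℝ)) p := by
    rw [show reflection c = fun p => (2 : ℝ) • c - p from funext (reflection_eq c)]
    exact (hasFDerivAt_id p).const_sub _
  have h := (hf (reflection c p)).hasFDerivAt.comp p hR
  change HasFDerivAt (fun q => f (reflection c q)) _ p at h
  simp [h.fderiv]

/-- Phase of the lift to the line bundle of the point reflection about `c`. -/
def parityPhase (Λ : ℝ × ℝ → ℝ) (c p : ℝ × ℝ) : ℝ :=
  Λ p - Λ (reflection c p) + c.1 / π * (p.2 - c.2)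

/-- Lift to sections of the line bundle of the point reflection about `c`. -/
def parity (Λ : ℝ × ℝ → ℝ) (c : ℝ × ℝ) (ψ : ℝ × ℝ → ℂ) (p : ℝ × ℝ) : ℂ :=
  Complex.exp (Complex.I * (parityPhase Λ c p : ℝ)) * ψ (reflection c p)

namespace MagneticTorus.IsLandauGauge

variable {M : MagneticTorus 1} {Λ : ℝ × ℝ → ℝ} {a b : ℝ} {c : ℝ × ℝ}

theorem smooth_parityPhase (h : M.IsLandauGauge Λ a b) : ContDiff ℝ ∞ (parityPhase Λ c) := by
  have h1 := h.smooth
  have h2 := h1.comp (smooth_reflection c)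
  exact (h1.sub h2).add (by fun_prop)

theorem smooth_parity (h : M.IsLandauGauge Λ a b) {ψ : ℝ × ℝ → ℂ} (hψ : ContDiff ℝ ∞ ψ) :
    ContDiff ℝ ∞ (parity Λ c ψ) := by
  have h1 : ContDiff ℝ ∞ (fun p => ((parityPhase Λ c p : ℝ) : ℂ)) :=
    Complex.ofRealCLM.contDiff.comp h.smooth_parityPhase
  exact (contDiff_const.mul h1).cexp.mul (hψ.comp (smooth_reflection c))

theorem fderiv_parityPhase (h : M.IsLandauGauge Λ a b) (p v : ℝ × ℝ) :
    fderiv ℝ (parityPhase Λ c) p v =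
      fderiv ℝ Λ p v + fderiv ℝ Λ (reflection c p) v + c.1 / π * v.2 := by
  have hR : DifferentiableAt ℝ (fun q => Λ (reflection c q)) p :=
    ((h.smooth.comp (smooth_reflection c)).differentiable (by simp)) p
  have hS : DifferentiableAt ℝ (fun q => Λ q - Λ (reflection c q)) p := (h.differentiable p).sub hR
  have hl : HasFDerivAt (fun q : ℝ × ℝ => c.1 / π * (q.2 - c.2))
      ((c.1 / π) • ContinuousLinearMap.snd ℝ ℝ ℝ) p :=
    ((hasFDerivAt_snd (𝕜 := ℝ) (p := p)).sub_const c.2).const_mul _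
  have : parityPhase Λ c = fun q => Λ q - Λ (reflection c q) + c.1 / π * (q.2 - c.2) := rfl
  rw [this, fderiv_fun_add hS hl.differentiableAt, fderiv_fun_sub (h.differentiable p) hR, hl.fderiv]
  simp [fderiv_comp_reflection h.differentiable]

theorem fderiv_parity (h : M.IsLandauGauge Λ a b) {ψ : ℝ × ℝ → ℂ} (hψ : Differentiable ℝ ψ)
    (p v : ℝ × ℝ) : fderiv ℝ (parity Λ c ψ) p v =
      Complex.exp (Complex.I * (parityPhase Λ c p : ℝ)) *
        (Complex.I * (fderiv ℝ (parityPhase Λ c) p v : ℝ) * ψ (reflection c p) -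
          fderiv ℝ ψ (reflection c p) v) := by
  have hR : DifferentiableAt ℝ (fun q => ψ (reflection c q)) p :=
    (hψ _).comp p ((smooth_reflection c).differentiable (by simp) p)
  have := fderiv_exp_I_mul_mul (h.smooth_parityPhase (c := c) |>.differentiable (by simp) p) hR v
  rw [fderiv_comp_reflection hψ] at this
  rw [sub_eq_add_neg]
  exact this

/-- Reflection reverses the derivative, and the gradient of `parityPhase` makes up for the change of
potential. The sign disappears in the second-order Hamiltonian. -/
theorem D₁_parity (h : M.IsLandauGauge Λ a b) {ψ : ℝ × ℝ → ℂ} (hψ : Differentiable ℝ ψ) :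
    M.D₁ (parity Λ c ψ) = parity Λ c (-M.D₁ ψ) := by
  ext p
  rw [D₁, h.fderiv_parity hψ, h.fderiv_parityPhase, h.fderiv_fst, h.fderiv_fst]
  simp only [parity, Pi.neg_apply, D₁]
  push_cast; ring

theorem D₂_parity (h : M.IsLandauGauge Λ a b) {ψ : ℝ × ℝ → ℂ} (hψ : Differentiable ℝ ψ) :
    M.D₂ (parity Λ c ψ) = parity Λ c (-M.D₂ ψ) := by
  ext p
  -- The Landau potentials at `p` and at its reflection add up to `c.1 / π`, the slope of the linear
  -- term in `parityPhase`.
  have e : M.A₂ p - p.1 / (2 * π) + (M.A₂ (reflection c p) - (reflection c p).1 / (2 * π)) +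
      c.1 / π * 1 = M.A₂ p + M.A₂ (reflection c p) := by
    simp only [reflection]; field_simp; ring
  rw [D₂, h.fderiv_parity hψ, h.fderiv_parityPhase, h.fderiv_snd, h.fderiv_snd, e]
  simp only [parity, Pi.neg_apply, D₂]
  push_cast; ring

theorem hamiltonian_parity (h : M.IsLandauGauge Λ a b) {V : ℝ × ℝ → ℝ}
    (hV : ∀ p, V (reflection c p) = V p) {ψ : ℝ × ℝ → ℂ} (hψ : ContDiff ℝ ∞ ψ) :
    M.hamiltonian V (parity Λ c ψ) = parity Λ c (M.hamiltonian V ψ) := by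
  have hd {φ : ℝ × ℝ → ℂ} (hφ : ContDiff ℝ ∞ φ) : Differentiable ℝ φ :=
    hφ.differentiable (by simp)
  have e₁ : -M.D₁ (-M.D₁ ψ) = M.D₁ (M.D₁ ψ) := by
    ext p; simp only [Pi.neg_apply, D₁, fderiv_neg, _root_.neg_apply]; ring
  have e₂ : -M.D₂ (-M.D₂ ψ) = M.D₂ (M.D₂ ψ) := by
    ext p; simp only [Pi.neg_apply, D₂, fderiv_neg, _root_.neg_apply]; ring
  ext p
  rw [hamiltonian, h.D₁_parity (hd hψ), h.D₁_parity (hd (smooth_D₁ hψ)).neg, e₁,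
    h.D₂_parity (hd hψ), h.D₂_parity (hd (smooth_D₂ hψ)).neg, e₂]
  simp only [parity, hamiltonian, hV]
  ring

/-- Reflection turns a period into its inverse; the phases then mismatch by `-2 (c.2 + a)` and `2
(c.1 - b)`, multiples of `2π` by the choice of `c`. -/
theorem isSection_parity (h : M.IsLandauGauge Λ a b) {j₁ j₂ : ℤ}
    (hb : c.1 - b = j₁ * (2 * π)) (ha : c.2 + a = j₂ * (2 * π)) {ψ : ℝ × ℝ → ℂ}
    (hψ : M.IsSection ψ) : M.IsSection (parity Λ c ψ) := by
  constructor
  · intro x y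
    have h1 := h.section_shift hψ (-1) 0 (2 * c.1 - x) (2 * c.2 - y)
    have e : reflection c (x + 2 * π, y) =
        (2 * c.1 - x + ((-1 : ℤ) : ℝ) * (2 * π), 2 * c.2 - y + ((0 : ℤ) : ℝ) * (2 * π)) := by
      simp [reflection]; ring
    simp only [parity, parityPhase, e, h1]
    rw [← mul_assoc (Complex.exp _), ← mul_assoc (Complex.exp _), ← Complex.exp_add, ← Complex.exp_add, ← mul_add, ← mul_add,
      ← Complex.ofReal_add, ← Complex.ofReal_add, h.shift_fst]
    congr 1
    refine exp_I_mul_eq_of_sub_eq (-2 * j₂) ?_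
    simp only [reflection]; push_cast
    linear_combination (-2) * ha
  · intro x y
    have h1 := h.section_shift hψ 0 (-1) (2 * c.1 - x) (2 * c.2 - y)
    have e : reflection c (x, y + 2 * π) =
        (2 * c.1 - x + ((0 : ℤ) : ℝ) * (2 * π), 2 * c.2 - y + ((-1 : ℤ) : ℝ) * (2 * π)) := by
      simp [reflection]; ring
    simp only [parity, parityPhase, e, h1]
    rw [← mul_assoc (Complex.exp _), ← mul_assoc (Complex.exp _), ← Complex.exp_add, ← Complex.exp_add, ← mul_add, ← mul_add,
      ← Complex.ofReal_add, ← Complex.ofReal_add, h.shift_snd]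
    congr 1
    refine exp_I_mul_eq_of_sub_eq (2 * j₁) ?_
    have e2 : c.1 / π * (y + 2 * π - c.2) = c.1 / π * (y - c.2) + 2 * c.1 := by field_simp; ring
    simp only [reflection, e2]; push_cast
    linear_combination 2 * hb

/-- At a fixed point `c + π (m, n)` of the reflection on the torus, the parity acts on the fibre
by the sign `(-1)^(m n)`. -/
theorem parity_apply_fixedPoint (h : M.IsLandauGauge Λ a b) {j₁ j₂ : ℤ}
    (hb : c.1 - b = j₁ * (2 * π)) (ha : c.2 + a = j₂ * (2 * π)) {ψ : ℝ × ℝ → ℂ}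
    (hψ : M.IsSection ψ) {p : ℝ × ℝ} {m n : ℤ} (h₁ : p.1 = c.1 + m * π) (h₂ : p.2 = c.2 + n * π) :
    parity Λ c ψ p = Complex.exp (Complex.I * ((m * n : ℤ) * π : ℝ)) * ψ p := by
  have h1 := h.section_shift hψ (-m) (-n) p.1 p.2
  have e : reflection c p =
      (p.1 + ((-m : ℤ) : ℝ) * (2 * π), p.2 + ((-n : ℤ) : ℝ) * (2 * π)) := by
    simp only [reflection, h₁, h₂]; push_cast; ext <;> simp <;> ring
  simp only [parity, parityPhase, e, h1]
  rw [← mul_assoc, ← Complex.exp_add, ← mul_add, ← Complex.ofReal_add]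
  congr 1
  -- Once `Λ` cancels, the phase is `n (c.1 - b) - m (c.2 + a) - m n π`. The first two terms are
  -- multiples of `2π`, and `-m n π` agrees with `m n π` modulo `2π`.
  refine exp_I_mul_eq_of_sub_eq (j₁ * n - m * j₂ - m * n) ?_
  have e2 : c.1 / π * (p.2 - c.2) = c.1 * n := by rw [h₂]; field_simp; ring
  rw [e2]
  push_cast
  linear_combination n * hb - m * ha - m * h₂

end MagneticTorus.IsLandauGauge

/-! ### The parity in the trivialization over the fundamental domain -/

/-- The reflection about `c` as a map of the fundamental domain into itself. -/
def foldedReflection (c p : ℝ × ℝ) : ℝ × ℝ :=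
  (toIcoMod two_pi_pos 0 (2 * c.1 - p.1), toIcoMod two_pi_pos 0 (2 * c.2 - p.2))

/-- The factor by which `parity` acts in the trivialization over the fundamental domain. -/
def parityFactor (Λ : ℝ × ℝ → ℝ) (a b : ℝ) (c p : ℝ × ℝ) : ℂ :=
  Complex.exp (Complex.I * (Λ p - Λ (foldedReflection c p) + c.1 / π * (p.2 - c.2) +
    toIcoDiv two_pi_pos 0 (2 * c.1 - p.1) * ((foldedReflection c p).2 + a) +
    toIcoDiv two_pi_pos 0 (2 * c.2 - p.2) * b : ℝ))

theorem toIcoMod_two_pi_eq (x : ℝ) :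
    toIcoMod two_pi_pos 0 x = x - toIcoDiv two_pi_pos 0 x * (2 * π) := by
  have := toIcoMod_add_toIcoDiv_zsmul two_pi_pos 0 x
  rw [zsmul_eq_mul] at this
  linarith

theorem measurable_toIcoDiv_two_pi : Measurable (fun x : ℝ => toIcoDiv two_pi_pos 0 x) := by
  simp only [toIcoDiv_eq_floor]
  exact Int.measurable_floor.comp (by fun_prop)

theorem toIcoMod_sub_toIcoMod {x : ℝ} (hx : x ∈ Ico 0 (2 * π)) (d : ℝ) :
    toIcoMod two_pi_pos 0 (d - toIcoMod two_pi_pos 0 (d - x)) = x := by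
  have e : d - toIcoMod two_pi_pos 0 (d - x) = x + toIcoDiv two_pi_pos 0 (d - x) • (2 * π) := by
    rw [toIcoMod_two_pi_eq, zsmul_eq_mul]; ring
  rw [e, toIcoMod_add_zsmul, toIcoMod_eq_self]
  simpa using hx

theorem toIcoDiv_sub_toIcoMod {x : ℝ} (hx : x ∈ Ico 0 (2 * π)) (d : ℝ) :
    toIcoDiv two_pi_pos 0 (d - toIcoMod two_pi_pos 0 (d - x)) =
      toIcoDiv two_pi_pos 0 (d - x) := by
  have e : d - toIcoMod two_pi_pos 0 (d - x) = x + toIcoDiv two_pi_pos 0 (d - x) • (2 * π) := by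
    rw [toIcoMod_two_pi_eq, zsmul_eq_mul]; ring
  have h0 : toIcoDiv two_pi_pos 0 x = 0 := by
    apply toIcoDiv_eq_of_sub_zsmul_mem_Ico
    simpa using hx
  rw [e, toIcoDiv_add_zsmul, h0, zero_add]

/-- The map is `z ↦ d - z` on the circle, which preserves Haar measure, read through the
identification of the circle with `[0, 2π)`. -/
theorem measurePreserving_toIcoMod_sub (d : ℝ) :
    MeasurePreserving (fun x => toIcoMod two_pi_pos 0 (d - x))
      (volume.restrict (Ico 0 (2 * π))) (volume.restrict (Ico 0 (2 * π))) := by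
  have : Fact (0 < 2 * π) := ⟨two_pi_pos⟩
  have hmk : MeasurePreserving ((↑) : ℝ → AddCircle (2 * π)) (volume.restrict (Ico 0 (2 * π)))
      volume := by
    have := AddCircle.measurePreserving_mk (2 * π) 0
    rwa [zero_add, ← restrict_Ico_eq_restrict_Ioc] at this
  let g : AddCircle (2 * π) → ℝ := fun z => AddCircle.equivIco (2 * π) 0 z
  have hgm : Measurable g :=
    measurable_subtype_coe.comp (AddCircle.measurableEquivIco (2 * π) 0).measurable
  have hg : MeasurePreserving g volume (volume.restrict (Ico 0 (2 * π))) := by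
    refine ⟨hgm, ?_⟩
    rw [← hmk.map_eq, Measure.map_map hgm hmk.measurable]
    have : (g ∘ ((↑) : ℝ → AddCircle (2 * π))) =ᵐ[volume.restrict (Ico 0 (2 * π))] id := by
      filter_upwards [ae_restrict_mem measurableSet_Ico] with x hx
      simp [g, AddCircle.equivIco_coe_eq (p := 2 * π) (a := 0) (x := x) (by simpa using hx)]
    rw [Measure.map_congr this, Measure.map_id]
  have := (hg.comp (Measure.measurePreserving_sub_left volume ((d : ℝ) : AddCircle (2 * π)))).comp
    hmk
  convert! this using 1

theorem torusMeasure_eq_prod : torusMeasure =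
    (volume.restrict (Ico 0 (2 * π))).prod (volume.restrict (Ico 0 (2 * π))) := by
  rw [torusMeasure, Measure.prod_restrict]; rfl

/-- The closed fundamental square. -/
def square : Set (ℝ × ℝ) := Icc 0 (2 * π) ×ˢ Icc 0 (2 * π)

theorem isCompact_square : IsCompact square := isCompact_Icc.prod isCompact_Icc

theorem square_subset_closure_interior : square ⊆ closure (interior square) := by
  have : (0 : ℝ) ≠ 2 * π := two_pi_pos.ne
  rw [square, interior_prod_eq, closure_prod_eq, closure_interior_Icc this]

theorem torusMeasure_eq_restrict_square : torusMeasure = volume.restrict square := by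
  rw [torusMeasure_eq_prod, restrict_Ico_eq_restrict_Icc, Measure.prod_restrict]; rfl

instance : IsFiniteMeasure torusMeasure := by
  rw [torusMeasure_eq_restrict_square]
  exact ⟨by simpa using isCompact_square.measure_lt_top⟩

theorem ae_torusMeasure_mem : ∀ᵐ p ∂torusMeasure, p.1 ∈ Ico 0 (2 * π) ∧ p.2 ∈ Ico 0 (2 * π) :=
  ae_restrict_mem (measurableSet_Ico.prod measurableSet_Ico)

theorem measurePreserving_foldedReflection (c : ℝ × ℝ) :
    MeasurePreserving (foldedReflection c) torusMeasure torusMeasure := by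
  rw [torusMeasure_eq_prod]
  exact (measurePreserving_toIcoMod_sub (2 * c.1)).prod (measurePreserving_toIcoMod_sub (2 * c.2))

theorem foldedReflection_foldedReflection (c : ℝ × ℝ) {p : ℝ × ℝ} (h₁ : p.1 ∈ Ico 0 (2 * π))
    (h₂ : p.2 ∈ Ico 0 (2 * π)) : foldedReflection c (foldedReflection c p) = p :=
  Prod.ext (toIcoMod_sub_toIcoMod h₁ _) (toIcoMod_sub_toIcoMod h₂ _)

theorem norm_exp_I_mul (t : ℝ) : ‖Complex.exp (Complex.I * (t : ℝ))‖ = 1 := by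
  rw [mul_comm, Complex.norm_exp_ofReal_mul_I]

theorem norm_parityFactor (Λ : ℝ × ℝ → ℝ) (a b : ℝ) (c p : ℝ × ℝ) :
    ‖parityFactor Λ a b c p‖ = 1 :=
  norm_exp_I_mul _

theorem measurable_parityFactor {Λ : ℝ × ℝ → ℝ} (hΛ : Continuous Λ) (a b : ℝ) (c : ℝ × ℝ) :
    Measurable (parityFactor Λ a b c) := by
  have h1 := (measurePreserving_foldedReflection c).measurable
  have h2 (d : ℝ) : Measurable fun x : ℝ => (toIcoDiv two_pi_pos 0 (d - x) : ℝ) :=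
    (measurable_from_top (f := fun n : ℤ => (n : ℝ))).comp
      (measurable_toIcoDiv_two_pi.comp (by fun_prop))
  have h3 := hΛ.measurable
  refine (Measurable.const_mul (Complex.measurable_ofReal.comp ?_) Complex.I).cexp
  exact (((h3.sub (h3.comp h1)).add (by fun_prop)).add
    (((h2 _).comp measurable_fst).mul (h1.snd.add_const a))).add
      (((h2 _).comp measurable_snd).mul_const b)

/-- Pointwise form of `P² = 1`. Both foldings use the same integers `m`, `n`, so `Λ` cancels and
what remains is a multiple of `2π`. -/
theorem parityFactor_mul_parityFactor (Λ : ℝ × ℝ → ℝ) {a b : ℝ} {c : ℝ × ℝ} {j₁ j₂ : ℤ}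
    (hb : c.1 - b = j₁ * (2 * π)) (ha : c.2 + a = j₂ * (2 * π)) {p : ℝ × ℝ}
    (h₁ : p.1 ∈ Ico 0 (2 * π)) (h₂ : p.2 ∈ Ico 0 (2 * π)) :
    parityFactor Λ a b c p * parityFactor Λ a b c (foldedReflection c p) = 1 := by
  have d₁ : toIcoDiv two_pi_pos 0 (2 * c.1 - (foldedReflection c p).1) =
    toIcoDiv two_pi_pos 0 (2 * c.1 - p.1) := toIcoDiv_sub_toIcoMod h₁ _
  have d₂ : toIcoDiv two_pi_pos 0 (2 * c.2 - (foldedReflection c p).2) =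
    toIcoDiv two_pi_pos 0 (2 * c.2 - p.2) := toIcoDiv_sub_toIcoMod h₂ _
  have s₂ : (foldedReflection c p).2 = 2 * c.2 - p.2 -
    toIcoDiv two_pi_pos 0 (2 * c.2 - p.2) * (2 * π) := toIcoMod_two_pi_eq _
  rw [parityFactor, parityFactor, foldedReflection_foldedReflection c h₁ h₂, d₁, d₂,
    ← Complex.exp_add, ← mul_add, ← Complex.ofReal_add]
  set m := toIcoDiv two_pi_pos 0 (2 * c.1 - p.1)
  set n := toIcoDiv two_pi_pos 0 (2 * c.2 - p.2)
  set q := foldedReflection c p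
  rw [exp_I_mul_eq_of_sub_eq (v := 0) (-2 * j₁ * n + 2 * m * j₂ - m * n)]
  · simp
  · have e : c.1 / π * (q.2 - c.2) = -(c.1 / π * (p.2 - c.2)) - 2 * n * c.1 := by
      rw [s₂]; field_simp; ring
    rw [e]
    push_cast
    linear_combination (-2 * n) * hb + 2 * m * ha + m * s₂

theorem MagneticTorus.IsLandauGauge.parity_eq {M : MagneticTorus 1} {Λ : ℝ × ℝ → ℝ} {a b : ℝ}
    (h : M.IsLandauGauge Λ a b) (c : ℝ × ℝ) {ψ : ℝ × ℝ → ℂ} (hψ : M.IsSection ψ) (p : ℝ × ℝ) :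
    parity Λ c ψ p = parityFactor Λ a b c p * ψ (foldedReflection c p) := by
  have h1 := h.section_shift hψ (toIcoDiv two_pi_pos 0 (2 * c.1 - p.1))
    (toIcoDiv two_pi_pos 0 (2 * c.2 - p.2)) (foldedReflection c p).1 (foldedReflection c p).2
  have e : ((foldedReflection c p).1 + toIcoDiv two_pi_pos 0 (2 * c.1 - p.1) * (2 * π),
      (foldedReflection c p).2 + toIcoDiv two_pi_pos 0 (2 * c.2 - p.2) * (2 * π)) =
      reflection c p := by
    simp [foldedReflection, reflection]
  rw [e] at h1
  rw [parity, h1, parityFactor, ← mul_assoc, ← Complex.exp_add, parityPhase]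
  congr 2
  push_cast; ring

theorem MagneticTorus.IsLandauGauge.section_eq_zero {M : MagneticTorus 1} {Λ : ℝ × ℝ → ℝ}
    {a b : ℝ} (h : M.IsLandauGauge Λ a b) {ψ : ℝ × ℝ → ℂ} (hψ : M.IsSection ψ)
    (h0 : ∀ p ∈ square, ψ p = 0) (p : ℝ × ℝ) : ψ p = 0 := by
  have h1 := h.section_shift hψ (toIcoDiv two_pi_pos 0 p.1) (toIcoDiv two_pi_pos 0 p.2)
    (toIcoMod two_pi_pos 0 p.1) (toIcoMod two_pi_pos 0 p.2)
  have hm : ∀ x : ℝ, toIcoMod two_pi_pos 0 x ∈ Icc 0 (2 * π) := fun x => by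
    simpa using Ico_subset_Icc_self (toIcoMod_mem_Ico two_pi_pos 0 x)
  rw [h0 (toIcoMod two_pi_pos 0 p.1, toIcoMod two_pi_pos 0 p.2) ⟨hm _, hm _⟩, mul_zero] at h1
  rw [← h1]
  simp

/-! ### Operators on `L²` and continuous integral kernels -/

/-- Composition with a measure preserving map followed by multiplication by a unimodular function
is a bounded operator on `L²`. -/
theorem exists_weighted_composition {α : Type*} [MeasurableSpace α] {μ : Measure α} {σ : α → α}
    (hσ : MeasurePreserving σ μ μ) {w : α → ℂ} (hw : Measurable w) (hw1 : ∀ p, ‖w p‖ = 1) :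
    ∃ P : Lp ℂ 2 μ →L[ℂ] Lp ℂ 2 μ, ∀ f : Lp ℂ 2 μ, P f =ᵐ[μ] fun p => w p * f (σ p) := by
  have hmeas : ∀ f : Lp ℂ 2 μ, AEStronglyMeasurable (fun p => w p * f (σ p)) μ := fun f =>
    hw.aestronglyMeasurable.mul
      ((Lp.aestronglyMeasurable f).comp_measurePreserving hσ)
  have hnorm : ∀ f : Lp ℂ 2 μ, ∀ᵐ p ∂μ, ‖w p * f (σ p)‖ = ‖(f ∘ σ) p‖ := fun f =>
    Eventually.of_forall fun p => by simp [hw1]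
  have hmem : ∀ f : Lp ℂ 2 μ, MemLp (fun p => w p * f (σ p)) 2 μ := fun f =>
    ((Lp.memLp f).comp_measurePreserving hσ).congr_norm (hmeas f)
      ((hnorm f).mono fun p hp => hp.symm)
  have hcomp : ∀ {u v : α → ℂ}, u =ᵐ[μ] v → u ∘ σ =ᵐ[μ] v ∘ σ := fun h =>
    hσ.quasiMeasurePreserving.ae_eq_comp h
  let P₀ : Lp ℂ 2 μ →ₗ[ℂ] Lp ℂ 2 μ :=
    { toFun := fun f => (hmem f).toLp
      map_add' := fun f g => by
        apply Lp.ext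
        filter_upwards [(hmem (f + g)).coeFn_toLp, (hmem f).coeFn_toLp, (hmem g).coeFn_toLp,
          Lp.coeFn_add (hmem f).toLp (hmem g).toLp, hcomp (Lp.coeFn_add f g)] with p h1 h2 h3 h4 h5
        simp only [Function.comp_apply, Pi.add_apply] at h4 h5
        rw [h1, h4, h2, h3, h5, mul_add]
      map_smul' := fun r f => by
        apply Lp.ext
        filter_upwards [(hmem (r • f)).coeFn_toLp, (hmem f).coeFn_toLp,
          Lp.coeFn_smul r (hmem f).toLp, hcomp (Lp.coeFn_smul r f)] with p h1 h2 h3 h4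
        simp only [Function.comp_apply, Pi.smul_apply, smul_eq_mul, RingHom.id_apply] at h3 h4 ⊢
        rw [h1, h3, h2, h4]; ring }
  refine ⟨P₀.mkContinuous 1 fun f => ?_, fun f => (hmem f).coeFn_toLp⟩
  rw [one_mul]
  refine le_of_eq ?_
  change ‖(hmem f).toLp‖ = ‖f‖
  rw [Lp.norm_toLp, eLpNorm_congr_norm_ae (hnorm f),
    eLpNorm_comp_measurePreserving (Lp.aestronglyMeasurable f) hσ, Lp.norm_def]

theorem memLp_torusMeasure_of_continuous {φ : ℝ × ℝ → ℂ} (hφ : Continuous φ) :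
    MemLp φ 2 torusMeasure := by
  obtain ⟨C, hC⟩ := isCompact_square.exists_bound_of_continuousOn hφ.continuousOn
  refine MemLp.of_bound hφ.aestronglyMeasurable C ?_
  rw [torusMeasure_eq_restrict_square]
  filter_upwards [ae_restrict_mem isCompact_square.measurableSet] with p hp using hC p hp

theorem integrable_torusMeasure_of_continuous {φ : ℝ × ℝ → ℂ} (hφ : Continuous φ) :
    Integrable φ torusMeasure :=
  (memLp_torusMeasure_of_continuous hφ).integrable (by norm_num)

theorem eqOn_square_of_ae_eq {E : Type*} [TopologicalSpace E] [T2Space E] {f g : ℝ × ℝ → E}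
    (h : f =ᵐ[torusMeasure] g) (hf : Continuous f) (hg : Continuous g) : EqOn f g square := by
  rw [torusMeasure_eq_restrict_square] at h
  exact Measure.eqOn_of_ae_eq h hf.continuousOn hg.continuousOn square_subset_closure_interior

/-- A continuous kernel whose integral operator vanishes on continuous functions is zero. -/
theorem kernel_eq_zero_of_integral_eq_zero {G : ℝ × ℝ → ℝ × ℝ → ℂ}
    (hG : Continuous fun q : (ℝ × ℝ) × (ℝ × ℝ) => G q.1 q.2)
    (h : ∀ φ : ℝ × ℝ → ℂ, Continuous φ →
      ∀ᵐ x ∂torusMeasure, ∫ z, G x z * φ z ∂torusMeasure = 0) :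
    ∀ x ∈ square, ∀ z ∈ square, G x z = 0 := by
  intro x hx
  have hGx : Continuous (G x) := hG.comp (by fun_prop : Continuous fun z => (x, z))
  -- Testing against the conjugate of `G x` gives `∫ |G x z|²` at the point `x`. The hypothesis
  -- holds only for almost every point, so continuity of `F` is needed to evaluate it at `x` itself.
  have hφ : Continuous fun z => (starRingEnd ℂ) (G x z) := Complex.continuous_conj.comp hGx
  have hF : Continuous fun x' => ∫ z, G x' z * (starRingEnd ℂ) (G x z) ∂torusMeasure := by
    rw [torusMeasure_eq_restrict_square]
    exact continuous_parametric_integral_of_continuous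
      (f := fun x' z => G x' z * (starRingEnd ℂ) (G x z))
      (hG.mul (hφ.comp continuous_snd)) isCompact_square
  have hint := eqOn_square_of_ae_eq (h _ hφ) hF continuous_const hx
  simp only [Complex.mul_conj] at hint
  rw [integral_complex_ofReal, Complex.ofReal_eq_zero] at hint
  have hn : Continuous fun z => Complex.normSq (G x z) := Complex.continuous_normSq.comp hGx
  have hi : Integrable (fun z => Complex.normSq (G x z)) torusMeasure := by
    have := (integrable_torusMeasure_of_continuous (Complex.continuous_ofReal.comp hn)).re
    simpa using this
  rw [integral_eq_zero_iff_of_nonneg (fun z => Complex.normSq_nonneg _) hi] at hint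
  intro z hz
  exact Complex.normSq_eq_zero.1 (eqOn_square_of_ae_eq hint hn continuous_const hz)

/-! ### Parity invariance of the heat kernel -/

namespace MagneticTorus

theorem IsSection.sub {k : ℤ} {M : MagneticTorus k} {ψ φ : ℝ × ℝ → ℂ} (hψ : M.IsSection ψ)
    (hφ : M.IsSection φ) : M.IsSection (fun p => ψ p - φ p) :=
  ⟨fun x y => by simp only [hψ.1, hφ.1, mul_sub], fun x y => by simp only [hψ.2, hφ.2, mul_sub]⟩

theorem IsSection.const_mul {k : ℤ} {M : MagneticTorus k} {ψ : ℝ × ℝ → ℂ} (hψ : M.IsSection ψ)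
    (r : ℂ) : M.IsSection (fun p => r * ψ p) :=
  ⟨fun x y => by simp only [hψ.1]; ring, fun x y => by simp only [hψ.2]; ring⟩

namespace IsHeatSemigroup

variable {k : ℤ} {M : MagneticTorus k} {V : ℝ × ℝ → ℝ} {S : ℝ → StateSpace →L[ℂ] StateSpace}

theorem isC0Semigroup (hS : M.IsHeatSemigroup V S) : IsC0Semigroup S :=
  ⟨hS.zero, hS.add, hS.strongly_continuous⟩

/-- A bounded involution that preserves the graph of the Hamiltonian on smooth sections commutes
with the heat semigroup. -/
theorem commute_of_involution (hS : M.IsHeatSemigroup V S) {P : StateSpace →L[ℂ] StateSpace}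
    (hP : ∀ f, P (P f) = f)
    (hgraph : ∀ fg ∈ M.smoothGraph V, (P fg.1, P fg.2) ∈ M.smoothGraph V)
    {t : ℝ} (ht : 0 ≤ t) (f : StateSpace) : P (S t f) = S t (P f) := by
  have hcl : ∀ f g, (f, g) ∈ closure (M.smoothGraph V) →
      (P f, P g) ∈ closure (M.smoothGraph V) := fun f g h =>
    map_mem_closure (f := fun fg : StateSpace × StateSpace => (P fg.1, P fg.2))
      (by fun_prop) h hgraph
  have hcl' : ∀ f g, (P f, P g) ∈ closure (M.smoothGraph V) ↔
      (f, g) ∈ closure (M.smoothGraph V) := fun f g =>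
    ⟨fun h => by simpa [hP] using hcl _ _ h, hcl f g⟩
  have hS₀ := hS.isC0Semigroup
  -- Conjugation by the involution `P` carries the generator's graph to its image under `P × P`,
  -- which is the same closed graph.
  let S' : ℝ → StateSpace →L[ℂ] StateSpace := fun t => P.comp ((S t).comp P)
  have hS' : IsC0Semigroup S' := by
    refine ⟨?_, fun s t hs ht => ?_, fun f => ?_⟩
    · ext1 f; simp [S', hS.zero, hP]
    · ext1 f; simp [S', hS.add s t hs ht, hP]
    · have := (P.continuous.tendsto _).comp (hS.strongly_continuous (P f))
      rw [hP] at this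
      exact this
  have hgen : ∀ f g, HasGenerator S f g ↔ HasGenerator S' f g := by
    intro f g
    have key : HasGenerator S' f g ↔ HasGenerator S (P f) (P g) := by
      have e : ∀ t : ℝ, P ((t : ℂ)⁻¹ • (f - S' t f)) = (t : ℂ)⁻¹ • (P f - S t (P f)) := by
        intro t; simp [S', hP]
      constructor
      · intro h
        exact ((P.continuous.tendsto _).comp h).congr e
      · intro h
        have := (P.continuous.tendsto _).comp h
        rw [hP] at this
        refine this.congr fun t => ?_
        rw [Function.comp_apply, ← e, hP]
    rw [key]
    exact (hS.generator f g).trans ((hcl' f g).symm.trans (hS.generator _ _).symm)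
  have heq := hS₀.eq_of_hasGenerator_iff hS' hgen ht
  have := congrArg (fun L : StateSpace →L[ℂ] StateSpace => P (L f)) heq
  simpa [S', hP] using this

end IsHeatSemigroup

namespace IsLandauGauge

variable {M : MagneticTorus 1} {Λ : ℝ × ℝ → ℝ} {a b : ℝ} {c : ℝ × ℝ} {j₁ j₂ : ℤ}
  {V : ℝ × ℝ → ℝ}

/-- The parity about `c` as an operator on the space of states, commuting with the heat semigroup. -/
theorem exists_parity_operator (h : M.IsLandauGauge Λ a b) (hb : c.1 - b = j₁ * (2 * π))
    (ha : c.2 + a = j₂ * (2 * π)) (hV₁ : ∀ x y : ℝ, V (x + 2 * π, y) = V (x, y))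
    (hV₂ : ∀ x y : ℝ, V (x, y + 2 * π) = V (x, y)) (hV : ∀ p, V (reflection c p) = V p)
    {S : ℝ → StateSpace →L[ℂ] StateSpace} (hS : M.IsHeatSemigroup V S) :
    ∃ P : StateSpace →L[ℂ] StateSpace,
      (∀ f : StateSpace, P f =ᵐ[torusMeasure]
        fun p => parityFactor Λ a b c p * f (foldedReflection c p)) ∧
      ∀ t, 0 ≤ t → ∀ f, P (S t f) = S t (P f) := by
  have hσ := measurePreserving_foldedReflection c
  obtain ⟨P, hP⟩ := exists_weighted_composition hσ
    (measurable_parityFactor h.smooth.continuous a b c) (norm_parityFactor Λ a b c)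
  have hcomp : ∀ {u v : ℝ × ℝ → ℂ}, u =ᵐ[torusMeasure] v →
      u ∘ foldedReflection c =ᵐ[torusMeasure] v ∘ foldedReflection c := fun h =>
    hσ.quasiMeasurePreserving.ae_eq_comp h
  have hsec : ∀ (f : StateSpace) (u : ℝ × ℝ → ℂ), M.IsSection u → f =ᵐ[torusMeasure] u →
      P f =ᵐ[torusMeasure] parity Λ c u := by
    intro f u hu hfu
    filter_upwards [hP f, hcomp hfu] with p h1 h2
    rw [h1, h.parity_eq c hu]
    exact congrArg _ h2
  refine ⟨P, hP, fun t ht f => hS.commute_of_involution (fun f => ?_) ?_ ht f⟩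
  · apply Lp.ext
    filter_upwards [hP (P f), hcomp (hP f), ae_torusMeasure_mem] with p h1 h2 h3
    simp only [Function.comp_apply] at h2
    rw [h1, h2, foldedReflection_foldedReflection c h3.1 h3.2, ← mul_assoc,
      parityFactor_mul_parityFactor Λ hb ha h3.1 h3.2, one_mul]
  · rintro ⟨f, g⟩ ⟨u, hu, hus, hf, hg⟩
    refine ⟨parity Λ c u, h.smooth_parity hu, h.isSection_parity hb ha hus, hsec _ _ hus hf, ?_⟩
    rw [h.hamiltonian_parity hV hu]
    exact hsec _ _ (hus.hamiltonian hV₁ hV₂ hu) hg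

/-- The heat kernel is invariant under the parity about `c`. -/
theorem heatKernel_parity (h : M.IsLandauGauge Λ a b) (hb : c.1 - b = j₁ * (2 * π))
    (ha : c.2 + a = j₂ * (2 * π)) (hV₁ : ∀ x y : ℝ, V (x + 2 * π, y) = V (x, y))
    (hV₂ : ∀ x y : ℝ, V (x, y + 2 * π) = V (x, y)) (hV : ∀ p, V (reflection c p) = V p)
    {K : ℝ → ℝ × ℝ → ℝ × ℝ → ℂ} (hK : M.IsHeatKernel V K) {T : ℝ} (hT : 0 < T) (x z : ℝ × ℝ) :
    parity Λ c (fun x => K T x z) x =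
      (starRingEnd ℂ) (parity Λ c (fun z => (starRingEnd ℂ) (K T x z)) z) := by
  obtain ⟨S, hS, hSK⟩ := hK.kernel
  obtain ⟨P, hP, hPS⟩ := h.exists_parity_operator hb ha hV₁ hV₂ hV hS
  have hσ := measurePreserving_foldedReflection c
  have hw := measurable_parityFactor h.smooth.continuous a b c
  have hKc := hK.continuous T hT
  have hl := hK.section_left T hT
  have hr := hK.section_right T hT
  let E : ℝ × ℝ → ℂ := fun p => Complex.exp (Complex.I * (parityPhase Λ c p : ℝ))
  have hE : Continuous E := by
    have : Continuous (parityPhase Λ c) := h.smooth_parityPhase.continuous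
    fun_prop
  have hR : Continuous (reflection c) := (smooth_reflection c).continuous
  -- `G₁` and `G₂` are the kernels of `P S T` and `S T P`, written with the unfolded reflection so
  -- that they are visibly continuous.
  let G₁ : ℝ × ℝ → ℝ × ℝ → ℂ := fun x z => E x * K T (reflection c x) z
  let G₂ : ℝ × ℝ → ℝ × ℝ → ℂ := fun x z => (starRingEnd ℂ) (E z) * K T x (reflection c z)
  have hG₁c : Continuous fun q : (ℝ × ℝ) × (ℝ × ℝ) => G₁ q.1 q.2 :=
    (hE.comp continuous_fst).mul
      (hKc.comp ((hR.comp continuous_fst).prodMk continuous_snd))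
  have hG₂c : Continuous fun q : (ℝ × ℝ) × (ℝ × ℝ) => G₂ q.1 q.2 :=
    (Complex.continuous_conj.comp (hE.comp continuous_snd)).mul
      (hKc.comp (continuous_fst.prodMk (hR.comp continuous_snd)))
  have hG₁ : ∀ x z, G₁ x z = parityFactor Λ a b c x * K T (foldedReflection c x) z := fun x z =>
    h.parity_eq c (hl z) x
  have hG₂ : ∀ x z, G₂ x z =
      (starRingEnd ℂ) (parityFactor Λ a b c z) * K T x (foldedReflection c z) := fun x z => by
    have := congrArg (starRingEnd ℂ) (h.parity_eq c (hr x) z)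
    simpa [parity, G₂, E] using this
  have hint : ∀ φ : ℝ × ℝ → ℂ, Continuous φ →
      ∀ᵐ x ∂torusMeasure, ∫ z, (G₁ x z - G₂ x z) * φ z ∂torusMeasure = 0 := by
    intro φ hφ
    let f : StateSpace := (memLp_torusMeasure_of_continuous hφ).toLp
    have hf : f =ᵐ[torusMeasure] φ := (memLp_torusMeasure_of_continuous hφ).coeFn_toLp
    have hPST := hPS T hT.le f
    filter_upwards [hP (S T f), hSK T hT (P f),
      hσ.quasiMeasurePreserving.ae_eq_comp (hSK T hT f)] with x h1 h2 h3
    have hKx : Continuous (K T x) := hKc.comp (by fun_prop : Continuous fun z => (x, z))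
    have hG₁x : Continuous (G₁ x) := hG₁c.comp (by fun_prop : Continuous fun z => (x, z))
    have hG₂x : Continuous (G₂ x) := hG₂c.comp (by fun_prop : Continuous fun z => (x, z))
    have i1 : P (S T f) x = ∫ z, G₁ x z * φ z ∂torusMeasure := by
      simp only [Function.comp_apply] at h3
      rw [h1, h3, ← integral_const_mul]
      refine integral_congr_ae ?_
      filter_upwards [hf] with z hz
      rw [hz, hG₁, mul_assoc]
    have i2 : S T (P f) x = ∫ z, G₂ x z * φ z ∂torusMeasure := by
      -- The change of variables by the folded reflection moves `P` from `f` to the kernel; the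
      -- factor at the folded point is the inverse, hence the conjugate, of the factor at `z`.
      let F : ℝ × ℝ → ℂ := fun z =>
        K T x (foldedReflection c z) * parityFactor Λ a b c (foldedReflection c z) * φ z
      have hFm : Measurable F :=
        ((hKx.measurable.comp hσ.measurable).mul (hw.comp hσ.measurable)).mul hφ.measurable
      have e1 : ∫ z, K T x z * P f z ∂torusMeasure =
          ∫ z, F (foldedReflection c z) ∂torusMeasure := by
        refine integral_congr_ae ?_
        filter_upwards [hP f, hσ.quasiMeasurePreserving.ae_eq_comp hf, ae_torusMeasure_mem]
          with z h1 h2 h3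
        simp only [Function.comp_apply] at h2
        simp only [F]
        rw [h1, h2, foldedReflection_foldedReflection c h3.1 h3.2, mul_assoc]
      have e2 : ∫ z, F (foldedReflection c z) ∂torusMeasure = ∫ z, F z ∂torusMeasure := by
        conv_rhs => rw [← hσ.map_eq]
        rw [integral_map hσ.measurable.aemeasurable hFm.aestronglyMeasurable]
      rw [h2, e1, e2]
      refine integral_congr_ae ?_
      filter_upwards [ae_torusMeasure_mem] with z h3
      have hww := parityFactor_mul_parityFactor Λ hb ha h3.1 h3.2
      have hconj : (starRingEnd ℂ) (parityFactor Λ a b c z) =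
          parityFactor Λ a b c (foldedReflection c z) := by
        have hn : (starRingEnd ℂ) (parityFactor Λ a b c z) * parityFactor Λ a b c z = 1 := by
          rw [mul_comm, Complex.mul_conj, Complex.normSq_eq_norm_sq, norm_parityFactor]; simp
        exact left_inv_eq_right_inv hn hww
      rw [hG₂, hconj]
      simp only [F]
      ring
    simp only [sub_mul]
    rw [integral_sub (integrable_torusMeasure_of_continuous (hG₁x.fun_mul hφ))
        (integrable_torusMeasure_of_continuous (hG₂x.fun_mul hφ)),
      ← i1, ← i2, hPST, sub_self]
  have hzero := kernel_eq_zero_of_integral_eq_zero (G := fun x z => G₁ x z - G₂ x z)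
    (hG₁c.sub hG₂c) hint
  -- Equality on the square extends by quasi-periodicity, first in `z` and then in `x`.
  have hzero' : ∀ x ∈ square, ∀ z, G₁ x z - G₂ x z = 0 := by
    intro x hx z
    have hs : M.IsSection fun z => (starRingEnd ℂ) (G₁ x z - G₂ x z) := by
      have h1 := ((hr (reflection c x)).const_mul ((starRingEnd ℂ) (E x))).sub
        (h.isSection_parity hb ha (hr x))
      convert! h1 using 2 with z
      simp [G₁, G₂, E, parity]
    have := h.section_eq_zero hs (fun z hz => by rw [hzero x hx z hz, map_zero]) z
    exact (map_eq_zero _).1 this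
  have hs : M.IsSection fun x => G₁ x z - G₂ x z :=
    (h.isSection_parity hb ha (hl z)).sub ((hl (reflection c z)).const_mul _)
  have := h.section_eq_zero hs (fun x hx => hzero' x hx z) x
  rw [sub_eq_zero] at this
  simpa [G₁, G₂, E, parity] using this

/-- The heat kernel vanishes between a fixed point of the reflection about `c` on whose fibre the
parity acts by `1` and one on whose fibre it acts by `-1`. -/
theorem heatKernel_eq_zero (h : M.IsLandauGauge Λ a b) (hb : c.1 - b = j₁ * (2 * π))
    (ha : c.2 + a = j₂ * (2 * π)) (hV₁ : ∀ x y : ℝ, V (x + 2 * π, y) = V (x, y))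
    (hV₂ : ∀ x y : ℝ, V (x, y + 2 * π) = V (x, y)) (hV : ∀ p, V (reflection c p) = V p)
    {K : ℝ → ℝ × ℝ → ℝ × ℝ → ℂ} (hK : M.IsHeatKernel V K) {T : ℝ} (hT : 0 < T) {x z : ℝ × ℝ}
    {m n m' n' : ℤ} (hx₁ : x.1 = c.1 + m * π) (hx₂ : x.2 = c.2 + n * π) (hx : m * n = 0)
    (hz₁ : z.1 = c.1 + m' * π) (hz₂ : z.2 = c.2 + n' * π) (hz : Odd (m' * n')) :
    K T x z = 0 := by
  have key := h.heatKernel_parity hb ha hV₁ hV₂ hV hK hT x z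
  rw [h.parity_apply_fixedPoint hb ha (hK.section_left T hT z) hx₁ hx₂,
    h.parity_apply_fixedPoint hb ha (hK.section_right T hT x) hz₁ hz₂, hx] at key
  obtain ⟨l, hl⟩ := hz
  -- As `m' n'` is odd, the sign on the fibre over `z` is `exp (i π) = -1`, while `m n = 0` gives
  -- `+1` over `x`.
  rw [exp_I_mul_eq_of_sub_eq (u := ((m' * n' : ℤ) : ℝ) * π) (v := π) l
    (by rw [hl]; push_cast; ring)] at key
  rw [mul_comm Complex.I (π : ℂ), Complex.exp_pi_mul_I] at key
  simp only [Int.cast_zero, zero_mul, Complex.ofReal_zero, mul_zero, Complex.exp_zero, one_mul,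
    map_neg, Complex.conj_conj, neg_mul] at key
  exact self_eq_neg.1 key

end IsLandauGauge

end MagneticTorus

/-! ### From holonomies to coordinates, and the conclusion -/

theorem exists_int_of_exp_I_mul_eq_one {t : ℝ} (h : Complex.exp (Complex.I * (t : ℝ)) = 1) :
    ∃ n : ℤ, t = n * (2 * π) := by
  obtain ⟨n, hn⟩ := Complex.exp_eq_one_iff.1 h
  refine ⟨n, ?_⟩
  have h2 : Complex.I * (t : ℂ) = Complex.I * ((n * (2 * π) : ℝ) : ℂ) := by
    rw [hn]; push_cast; ring
  exact_mod_cast mul_left_cancel₀ Complex.I_ne_zero h2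

theorem exists_int_of_exp_I_mul_eq_neg_one {t : ℝ}
    (h : Complex.exp (Complex.I * (t : ℝ)) = -1) : ∃ n : ℤ, t = π + n * (2 * π) := by
  have h1 : Complex.exp (Complex.I * ((t - π : ℝ) : ℂ)) = 1 := by
    rw [Complex.ofReal_sub, mul_sub, Complex.exp_sub, h, mul_comm, Complex.exp_pi_mul_I]
    norm_num
  obtain ⟨n, hn⟩ := exists_int_of_exp_I_mul_eq_one h1
  exact ⟨n, by linarith⟩

end HallTorus

end

theorem proposition3p1
    (M : HallTorus.MagneticTorus 1)
    (V : ℝ × ℝ → ℝ) (hV_meas : Measurable V) (hV_bdd : ∃ C : ℝ, ∀ p, |V p| ≤ C)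
    (hV_per₁ : ∀ x y : ℝ, V (x + 2 * Real.pi, y) = V (x, y))
    (hV_per₂ : ∀ x y : ℝ, V (x, y + 2 * Real.pi) = V (x, y))
    (φ₁p φ₁m φ₂p φ₂m : ℝ)
    (hφ₁p : M.holonomyα φ₁p = 1) (hφ₁m : M.holonomyα φ₁m = -1)
    (hφ₂p : M.holonomyβ φ₂p = 1) (hφ₂m : M.holonomyβ φ₂m = -1)
    (hV_symm : ∀ x y : ℝ, V (2 * φ₁p - x, 2 * φ₂p - y) = V (x, y))
    (K : ℝ → ℝ × ℝ → ℝ × ℝ → ℂ) (hK : M.IsHeatKernel V K) :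
    ∀ T : ℝ, 0 < T →
      K T (φ₁p, φ₂p) (φ₁m, φ₂m) = 0 ∧
      K T (φ₁p, φ₂m) (φ₁m, φ₂m) = 0 ∧
      K T (φ₁m, φ₂p) (φ₁m, φ₂m) = 0 := by
  intro T hT
  obtain ⟨Λ, a, b, h⟩ := M.exists_isLandauGauge
  rw [h.holonomyα_eq] at hφ₁p hφ₁m
  rw [h.holonomyβ_eq] at hφ₂p hφ₂m
  obtain ⟨j₁, hj₁⟩ := HallTorus.exists_int_of_exp_I_mul_eq_one hφ₁p
  obtain ⟨j₂, hj₂⟩ := HallTorus.exists_int_of_exp_I_mul_eq_one hφ₂p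
  obtain ⟨l₁, hl₁⟩ := HallTorus.exists_int_of_exp_I_mul_eq_neg_one hφ₁m
  obtain ⟨l₂, hl₂⟩ := HallTorus.exists_int_of_exp_I_mul_eq_neg_one hφ₂m
  have hb : ((φ₁p, φ₂p) : ℝ × ℝ).1 - b = j₁ * (2 * Real.pi) := hj₁
  have ha : ((φ₁p, φ₂p) : ℝ × ℝ).2 + a = (-j₂ : ℤ) * (2 * Real.pi) := by
    push_cast; linarith
  have h₁ : φ₁m = φ₁p + (2 * (l₁ - j₁) + 1 : ℤ) * Real.pi := by push_cast; linarith
  have h₂ : φ₂m = φ₂p + (2 * (j₂ - l₂ - 1) + 1 : ℤ) * Real.pi := by push_cast; linarith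
  -- Both coordinates of `φ_{--}` differ from those of `φ_{++}` by odd multiples of `π`; each of the
  -- other three points shares a coordinate with `φ_{++}`, which makes its product of indices zero.
  have hodd : Odd ((2 * (l₁ - j₁) + 1) * (2 * (j₂ - l₂ - 1) + 1)) :=
    (odd_two_mul_add_one _).mul (odd_two_mul_add_one _)
  have hV : ∀ p, V (HallTorus.reflection (φ₁p, φ₂p) p) = V p := fun p => hV_symm p.1 p.2
  have key := fun {x : ℝ × ℝ} {m n : ℤ} hx₁ hx₂ hx =>
    h.heatKernel_eq_zero hb ha hV_per₁ hV_per₂ hV hK hT (x := x) (z := (φ₁m, φ₂m)) (m := m)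
      (n := n) hx₁ hx₂ hx h₁ h₂ hodd
  refine ⟨key (m := 0) (n := 0) (by simp) (by simp) (by simp), ?_, ?_⟩
  · exact key (m := 0) (by simp) h₂ (by simp)
  · exact key (n := 0) h₁ (by simp) (by simp)
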